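/- Let $p\ge 0$ and let $\mathfrak g'=\mathfrak{sp}(2p,\mathbb C)$, realised as the complex block matrices $\begin{pmatrix}X&Y\\Z&-X^T\end{pmatrix}$ with $p\times p$ blocks, $Y=Y^T$, $Z=Z^T$. Let $\mathfrak k'$ be the subalgebra $Y=Z=0$, let $\mathfrak p^+$ be the subspace $X=Z=0$, let $\mathfrak p^-$ be the subspace $X=Y=0$, and put $\mathfrak p'=\mathfrak p^+\oplus\mathfrak p^-$, $\mathfrak q^\pm=\mathfrak k'+\mathfrak p^\pm$. Write $\mathfrak U(\cdot)$ for universal enveloping algebras and $S(\cdot)$ for symmetric algebras. Let $E$ and $F$ be finite-dimensional $\mathfrak k'$-modules over $\mathbb C$; regard $E$ as a $\mathfrak q^+$-module with $\mathfrak p^+$ acting by zero and $F$ as a $\mathfrak q^-$-module with $\mathfrak p^-$ acting by zero. Put $$V_E=\mathfrak U(\mathfrak g')\otimes_{\mathfrak U(\mathfrak q^+)}E,\qquad V_F=\mathfrak U(\mathfrak g')\otimes_{\mathfrak U(\mathfrak q^-)}F,\qquad V=\mathfrak U(\mathfrak g')\otimes_{\mathfrak U(\mathfrak k')}(E\otimes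 F),$$ and let $\mathfrak g'$ act diagonally on $V_E\otimes V_F=V_E\otimes_{\mathbb C}V_F$. Let $T:V\to V_E\otimes V_F$ be the $\mathfrak U(\mathfrak g')$-linear map with $T(1\otimes(e\otimes f))=(1\otimes e)\otimes(1\otimes f)$ for all $e\in E$, $f\in F$. For $n\ge 0$ let $M_n\subset\mathfrak U(\mathfrak g')$ be the span of all products $\alpha_1\cdots\alpha_r\beta_1\cdots\beta_s$ with $\alpha_i\in\mathfrak p^-$, $\beta_j\in\mathfrak p^+$ and $r+s\le n$. Let $V_n$, $(V_E)_n$ and $(V_F)_n$ be the subspaces of $V$, $V_E$ and $V_F$ spanned by the tensors $u\otimes w$ with $u\in M_n\,\mathfrak U(\mathfrak k')$ and $w$ in $E\otimes F$, $E$ and $F$ respectively, and let $(V_E\otimes V_F)_n=\sum_{r+s\le n}(V_E)_r\otimes(V_F)_s$. An element $x\in\mathfrak p'$ acts on the associated graded spaces $Gr(V)=\bigoplus_n V_n/V_{n-1}$ and $Gr(V_E\otimes V_F)=\bigoplus_n(V_E\otimes V_F)_n/(V_E\otimes V_F)_{n-1}$ (the term of index $-1$ being $0$) by sending the class of $v$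 in degree $n$ to the class of $xv$ in degree $n+1$; these operators commute and make both spaces $S(\mathfrak p')$-modules. Theorem. The map $T$ is an isomorphism of $\mathfrak U(\mathfrak g')$-modules. Moreover $T(V_n)\subset(V_E\otimes V_F)_n$ for every $n$, and the induced map $T_G:Gr(V)\to Gr(V_E\otimes V_F)$, sending the class of $v\in V_n$ to the class of $T(v)$, is an isomorphism of $S(\mathfrak p')$-modules. -/

import Mathlib

open scoped TensorProduct DirectSum

noncomputable section

namespace SpTensor

/-! ### The tensor product `B ⊗_A M` along a homomorphism of (noncommutative) algebras -/

section Induced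

variable {R A B M : Type*} [CommRing R] [Ring A] [Algebra R A] [Ring B] [Algebra R B]
  [AddCommGroup M] [Module R M]

/-- The `B`-submodule of `B ⊗[R] M` generated by all `b φ(a) ⊗ m - b ⊗ a m`. -/
def balancedRel (φ : A →ₐ[R] B) (ρ : A →ₐ[R] Module.End R M) : Submodule B (B ⊗[R] M) :=
  Submodule.span B {t | ∃ (b : B) (a : A) (m : M), t = (b * φ a) ⊗ₜ[R] m - b ⊗ₜ[R] (ρ a m)}

/-- The left `B`-module `B ⊗_A M`, where `B` is a right `A`-module through `φ : A → B` and
`M` is a left `A`-module through `ρ : A → End M`. -/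
def Induced (φ : A →ₐ[R] B) (ρ : A →ₐ[R] Module.End R M) : Type _ :=
  (B ⊗[R] M) ⧸ balancedRel φ ρ

namespace Induced

variable (φ : A →ₐ[R] B) (ρ : A →ₐ[R] Module.End R M)

instance : AddCommGroup (Induced φ ρ) :=
  inferInstanceAs (AddCommGroup ((B ⊗[R] M) ⧸ balancedRel φ ρ))

instance : Module B (Induced φ ρ) :=
  inferInstanceAs (Module B ((B ⊗[R] M) ⧸ balancedRel φ ρ))

instance : Module R (Induced φ ρ) :=
  inferInstanceAs (Module R ((B ⊗[R] M) ⧸ balancedRel φ ρ))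

instance : IsScalarTower R B (Induced φ ρ) :=
  inferInstanceAs (IsScalarTower R B ((B ⊗[R] M) ⧸ balancedRel φ ρ))

/-- The pure tensor `b ⊗ m` in `B ⊗_A M`, as a bilinear map. -/
def mk : B →ₗ[R] M →ₗ[R] Induced φ ρ :=
  (TensorProduct.mk R B M).compr₂ ((balancedRel φ ρ).mkQ.restrictScalars R)

theorem smul_mk (c b : B) (m : M) : c • mk φ ρ b m = mk φ ρ (c * b) m := rfl

theorem mk_mul (b : B) (a : A) (m : M) : mk φ ρ (b * φ a) m = mk φ ρ b (ρ a m) :=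
  (Submodule.Quotient.eq _).2 (Submodule.subset_span ⟨b, a, m, rfl⟩)

theorem smul_mem_map₂ {S S' : Submodule R B} {b : B} (h : ∀ u ∈ S, b * u ∈ S') {v : Induced φ ρ}
    (hv : v ∈ Submodule.map₂ (mk φ ρ) S ⊤) : b • v ∈ Submodule.map₂ (mk φ ρ) S' ⊤ := by
  suffices H : Submodule.map₂ (mk φ ρ) S ⊤ ≤ (Submodule.map₂ (mk φ ρ) S' ⊤).comap
      (Algebra.lsmul R R (Induced φ ρ) b) from H hv
  refine Submodule.map₂_le.2 fun u hu m hm => ?_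
  change b • mk φ ρ u m ∈ Submodule.map₂ (mk φ ρ) S' ⊤
  rw [smul_mk]
  exact Submodule.apply_mem_map₂ _ (h u hu) hm

variable {φ ρ} in
/-- Frobenius reciprocity: the `B`-linear map `B ⊗_A M → N`, `b ⊗ m ↦ b • f m`, attached to an
`A`-linear map `f : M → N`. -/
def lift {N : Type*} [AddCommGroup N] [Module R N] [Module B N] [IsScalarTower R B N]
    (f : M →ₗ[R] N) (hf : ∀ a m, f (ρ a m) = φ a • f m) : Induced φ ρ →ₗ[B] N :=
  (balancedRel φ ρ).liftQ
    (TensorProduct.AlgebraTensorModule.lift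
      ((LinearMap.toSpanSingleton B (M →ₗ[R] N) f)))
    (by
      refine Submodule.span_le.2 ?_
      rintro _ ⟨b, a, m, rfl⟩
      simp [hf, mul_smul])

theorem lift_mk {N : Type*} [AddCommGroup N] [Module R N] [Module B N] [IsScalarTower R B N]
    (f : M →ₗ[R] N) (hf : ∀ a m, f (ρ a m) = φ a • f m) (b : B) (m : M) :
    lift f hf (mk φ ρ b m) = b • f m := rfl

end Induced

end Induced

/-! ### Enveloping algebras -/

/-- The universal enveloping algebra of a complex Lie algebra. -/
abbrev U (L : Type*) [LieRing L] [LieAlgebra ℂ L] : Type _ := UniversalEnvelopingAlgebra ℂ L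

section Shortcuts

/-! Shortcuts for instance search. -/

variable (L : Type*) [LieRing L] [LieAlgebra ℂ L]

instance : Ring (U L) := inferInstance
instance : Semiring (U L) := inferInstance
instance : MonoidWithZero (U L) := inferInstance
instance : Monoid (U L) := inferInstance
instance : NonUnitalNonAssocSemiring (U L) := inferInstance
instance : AddCommGroup (U L) := inferInstance
instance : AddCommMonoid (U L) := inferInstance
instance : Mul (U L) := inferInstance
instance : One (U L) := inferInstance
instance : Algebra ℂ (U L) := inferInstance
instance : Module ℂ (U L) := inferInstance
instance : SMul ℂ (U L) := inferInstance
instance : SMul (U L) (U L) := inferInstance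

end Shortcuts

section Enveloping

section

attribute [local instance] LieRing.ofAssociativeRing

/-- The inclusion of a Lie algebra in its enveloping algebra. -/
def ιU (L : Type*) [LieRing L] [LieAlgebra ℂ L] : L →ₗ[ℂ] U L :=
  (UniversalEnvelopingAlgebra.ι ℂ : L →ₗ⁅ℂ⁆ U L)

variable {L : Type*} [LieRing L] [LieAlgebra ℂ L]

theorem ιU_lie (x y : L) : ιU L ⁅x, y⁆ = ιU L x * ιU L y - ιU L y * ιU L x :=
  (UniversalEnvelopingAlgebra.ι ℂ : L →ₗ⁅ℂ⁆ U L).map_lie x y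

theorem U.mem_of_ι_mem (S : Subalgebra ℂ (U L)) (hS : ∀ x, ιU L x ∈ S) (u : U L) : u ∈ S := by
  let g : L →ₗ⁅ℂ⁆ S :=
    { ((ιU L).codRestrict (Subalgebra.toSubmodule S) hS) with
      map_lie' := by
        intro x y
        apply Subtype.ext
        change ιU L ⁅x, y⁆ = ιU L x * ιU L y - ιU L y * ιU L x
        exact ιU_lie x y }
  have h : S.val.comp (UniversalEnvelopingAlgebra.lift ℂ g) = AlgHom.id ℂ (U L) := by
    apply UniversalEnvelopingAlgebra.hom_ext
    ext x
    change ((UniversalEnvelopingAlgebra.lift ℂ g (ιU L x) : S) : U L) = ιU L x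
    exact congrArg Subtype.val (UniversalEnvelopingAlgebra.lift_ι_apply ℂ g x)
  have h2 := congrArg (fun k => k u) h
  change ((UniversalEnvelopingAlgebra.lift ℂ g u : S) : U L) = u at h2
  rw [← h2]
  exact Subtype.mem _

/-- The action of `U(L)` on an `L`-module `M`. -/
def envAct (L M : Type*) [LieRing L] [LieAlgebra ℂ L] [AddCommGroup M] [Module ℂ M]
    [LieRingModule L M] [LieModule ℂ L M] : U L →ₐ[ℂ] Module.End ℂ M :=
  UniversalEnvelopingAlgebra.lift ℂ (LieModule.toEnd ℂ L M)

theorem env_equivariant {B M N : Type*} [Ring B] [Algebra ℂ B] [AddCommGroup M] [Module ℂ M]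
    [AddCommGroup N] [Module ℂ N] [Module B N] [IsScalarTower ℂ B N]
    (φ : U L →ₐ[ℂ] B) (ρ : U L →ₐ[ℂ] Module.End ℂ M) (f : M →ₗ[ℂ] N)
    (h : ∀ x m, f (ρ (ιU L x) m) = φ (ιU L x) • f m) (u : U L) (m : M) :
    f (ρ u m) = φ u • f m := by
  let S : Subalgebra ℂ (U L) :=
    { carrier := {a | ∀ m, f (ρ a m) = φ a • f m}
      mul_mem' := by
        intro a b ha hb m
        rw [map_mul, map_mul, Module.End.mul_apply, ha, hb, mul_smul]
      add_mem' := by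
        intro a b ha hb m
        rw [map_add, map_add, LinearMap.add_apply, map_add, ha, hb, add_smul]
      algebraMap_mem' := by
        intro r m
        rw [AlgHom.commutes, AlgHom.commutes, Module.algebraMap_end_apply, map_smul,
          algebraMap_smul] }
  exact U.mem_of_ι_mem S h u m

/-- The homomorphism `U(L₁) → U(L₂)` induced by a homomorphism `L₁ → L₂`. -/
def envMap {L₁ L₂ : Type*} [LieRing L₁] [LieAlgebra ℂ L₁] [LieRing L₂] [LieAlgebra ℂ L₂]
    (f : L₁ →ₗ⁅ℂ⁆ L₂) : U L₁ →ₐ[ℂ] U L₂ :=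
  UniversalEnvelopingAlgebra.lift ℂ ((UniversalEnvelopingAlgebra.ι ℂ).comp f)

theorem envAct_ι {M : Type*} [AddCommGroup M] [Module ℂ M] [LieRingModule L M] [LieModule ℂ L M]
    (x : L) (m : M) : envAct L M (ιU L x) m = ⁅x, m⁆ := by
  exact LinearMap.congr_fun (UniversalEnvelopingAlgebra.lift_ι_apply ℂ (LieModule.toEnd ℂ L M) x) m

theorem envMap_ι {L₁ L₂ : Type*} [LieRing L₁] [LieAlgebra ℂ L₁] [LieRing L₂] [LieAlgebra ℂ L₂]
    (f : L₁ →ₗ⁅ℂ⁆ L₂) (x : L₁) : envMap f (ιU L₁ x) = ιU L₂ (f x) := by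
  exact UniversalEnvelopingAlgebra.lift_ι_apply ℂ ((UniversalEnvelopingAlgebra.ι ℂ).comp f) x

end

variable {L : Type*} [LieRing L] [LieAlgebra ℂ L]

/-! ### Induced modules as Lie modules, and the diagonal action on tensor products -/

variable {A M : Type*} [Ring A] [Algebra ℂ A] [AddCommGroup M] [Module ℂ M]

instance (φ : A →ₐ[ℂ] U L) (ρ : A →ₐ[ℂ] Module.End ℂ M) : LieRingModule L (Induced φ ρ) where
  bracket x v := ιU L x • v
  add_lie x y v := by change ιU L (x + y) • v = _; rw [map_add, add_smul]
  lie_add x v w := smul_add _ _ _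
  leibniz_lie x y v := by
    change ιU L x • ιU L y • v = ιU L ⁅x, y⁆ • v + ιU L y • ιU L x • v
    rw [ιU_lie, sub_smul, mul_smul, mul_smul]
    abel

theorem Induced.lie_def (φ : A →ₐ[ℂ] U L) (ρ : A →ₐ[ℂ] Module.End ℂ M) (x : L)
    (v : Induced φ ρ) : ⁅x, v⁆ = ιU L x • v := rfl

instance (φ : A →ₐ[ℂ] U L) (ρ : A →ₐ[ℂ] Module.End ℂ M) : LieModule ℂ L (Induced φ ρ) where
  smul_lie c x v := by
    rw [Induced.lie_def, Induced.lie_def, map_smul, smul_assoc]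
  lie_smul c x v := by
    rw [Induced.lie_def, Induced.lie_def]
    exact smul_algebra_smul_comm c (ιU L x) v

instance (φ : A →ₐ[ℂ] U L) (ρ : A →ₐ[ℂ] Module.End ℂ M) : SMul (U L) (Induced φ ρ) := inferInstance

/-- The tensor product `X ⊗ Y` over `ℂ` of two `L`-modules, regarded as a `U(L)`-module by the
diagonal action `x (v ⊗ w) = x v ⊗ w + v ⊗ x w` of `x ∈ L`. -/
def DiagTensor (L X Y : Type*) [LieRing L] [LieAlgebra ℂ L]
    [AddCommGroup X] [Module ℂ X] [LieRingModule L X] [LieModule ℂ L X]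
    [AddCommGroup Y] [Module ℂ Y] [LieRingModule L Y] [LieModule ℂ L Y] : Type _ := X ⊗[ℂ] Y

namespace DiagTensor

variable (L) (X Y : Type*)
  [AddCommGroup X] [Module ℂ X] [LieRingModule L X] [LieModule ℂ L X]
  [AddCommGroup Y] [Module ℂ Y] [LieRingModule L Y] [LieModule ℂ L Y]

instance : AddCommGroup (DiagTensor L X Y) := inferInstanceAs (AddCommGroup (X ⊗[ℂ] Y))

instance : Module ℂ (DiagTensor L X Y) := inferInstanceAs (Module ℂ (X ⊗[ℂ] Y))

instance : Module (U L) (DiagTensor L X Y) :=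
  Module.compHom (X ⊗[ℂ] Y) (envAct L (X ⊗[ℂ] Y)).toRingHom

instance : IsScalarTower ℂ (U L) (DiagTensor L X Y) where
  smul_assoc c u t := by
    change envAct L (X ⊗[ℂ] Y) (c • u) t = c • envAct L (X ⊗[ℂ] Y) u t
    rw [map_smul]; rfl

/-- The pure tensor `v ⊗ w`, as a bilinear map. -/
def mk : X →ₗ[ℂ] Y →ₗ[ℂ] DiagTensor L X Y := TensorProduct.mk ℂ X Y

theorem ι_smul_mk (x : L) (v : X) (w : Y) :
    ιU L x • mk L X Y v w = mk L X Y ⁅x, v⁆ w + mk L X Y v ⁅x, w⁆ := by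
  change envAct L (X ⊗[ℂ] Y) (ιU L x) (v ⊗ₜ w) = _
  rw [envAct_ι, TensorProduct.LieModule.lie_tmul_right]
  rfl

end DiagTensor

section TensorUnit

variable {A' M' : Type*} [Ring A'] [Algebra ℂ A'] [AddCommGroup M'] [Module ℂ M']

theorem Induced.lie_one (φ : A →ₐ[ℂ] U L) (ρ : A →ₐ[ℂ] Module.End ℂ M) {x : L} {a : A}
    (h : φ a = ιU L x) (m : M) : ⁅x, Induced.mk φ ρ 1 m⁆ = Induced.mk φ ρ 1 (ρ a m) := by
  rw [← Induced.mk_mul, h, Induced.lie_def, Induced.smul_mk, one_mul, mul_one]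

/-- The linear map `m ⊗ m' ↦ (1 ⊗ m) ⊗ (1 ⊗ m')` into the tensor product of two modules of the
form `U(L) ⊗_A M` and `U(L) ⊗_{A'} M'`. -/
def tensorUnit (φ : A →ₐ[ℂ] U L) (ρ : A →ₐ[ℂ] Module.End ℂ M)
    (φ' : A' →ₐ[ℂ] U L) (ρ' : A' →ₐ[ℂ] Module.End ℂ M') :
    M ⊗[ℂ] M' →ₗ[ℂ] DiagTensor L (Induced φ ρ) (Induced φ' ρ') :=
  TensorProduct.lift ((DiagTensor.mk L (Induced φ ρ) (Induced φ' ρ')).compl₁₂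
    (Induced.mk φ ρ 1) (Induced.mk φ' ρ' 1))

theorem tensorUnit_tmul (φ : A →ₐ[ℂ] U L) (ρ : A →ₐ[ℂ] Module.End ℂ M)
    (φ' : A' →ₐ[ℂ] U L) (ρ' : A' →ₐ[ℂ] Module.End ℂ M') (m : M) (m' : M') :
    tensorUnit φ ρ φ' ρ' (m ⊗ₜ m') = DiagTensor.mk L (Induced φ ρ) (Induced φ' ρ')
      (Induced.mk φ ρ 1 m) (Induced.mk φ' ρ' 1 m') := rfl

theorem tensorUnit_equivariant {K : Type*} [LieRing K] [LieAlgebra ℂ K]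
    [LieRingModule K M] [LieModule ℂ K M] [LieRingModule K M'] [LieModule ℂ K M']
    (φ : A →ₐ[ℂ] U L) (ρ : A →ₐ[ℂ] Module.End ℂ M)
    (φ' : A' →ₐ[ℂ] U L) (ρ' : A' →ₐ[ℂ] Module.End ℂ M') (f : K →ₗ⁅ℂ⁆ L)
    (h : ∀ x : K, ∃ a, φ a = ιU L (f x) ∧ ∀ m, ρ a m = ⁅x, m⁆)
    (h' : ∀ x : K, ∃ a, φ' a = ιU L (f x) ∧ ∀ m, ρ' a m = ⁅x, m⁆)
    (u : U K) (t : M ⊗[ℂ] M') :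
    tensorUnit φ ρ φ' ρ' (envAct K (M ⊗[ℂ] M') u t) = envMap f u • tensorUnit φ ρ φ' ρ' t := by
  refine env_equivariant (envMap f) (envAct K (M ⊗[ℂ] M')) (tensorUnit φ ρ φ' ρ') ?_ u t
  intro x t
  rw [envAct_ι, envMap_ι]
  induction t using TensorProduct.induction_on with
  | zero => rw [lie_zero, map_zero, smul_zero]
  | add s t hs ht => rw [lie_add, map_add, map_add, smul_add, hs, ht]
  | tmul m m' =>
    obtain ⟨a, ha, hm⟩ := h x
    obtain ⟨a', ha', hm'⟩ := h' x
    rw [TensorProduct.LieModule.lie_tmul_right, map_add, tensorUnit_tmul, tensorUnit_tmul,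
      tensorUnit_tmul, DiagTensor.ι_smul_mk, Induced.lie_one φ ρ ha, Induced.lie_one φ' ρ' ha',
      hm, hm']

end TensorUnit

end Enveloping

/-! ### `sp(2p, ℂ)` and its subspaces -/

section

attribute [local instance] LieRing.ofAssociativeRing

/-- `sp(2p, ℂ)`: the `2p × 2p` matrices skew-adjoint for the standard symplectic form. -/
abbrev sp (p : ℕ) : LieSubalgebra ℂ (Matrix (Fin p ⊕ Fin p) (Fin p ⊕ Fin p) ℂ) :=
  LieAlgebra.Symplectic.sp (Fin p) ℂ

instance (p : ℕ) : LieRing (sp p) := inferInstance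

instance (p : ℕ) : LieAlgebra ℂ (sp p) := inferInstance

theorem sp_bracket {p : ℕ} (A B : sp p) : (⁅A, B⁆ : sp p).1 = A.1 * B.1 - B.1 * A.1 := rfl

end

section Blocks

open Matrix

variable {p : ℕ}

theorem mem_sp_iff (X Y Z W : Matrix (Fin p) (Fin p) ℂ) :
    fromBlocks X Y Z W ∈ sp p ↔ W = -Xᵀ ∧ Yᵀ = Y ∧ Zᵀ = Z := by
  rw [sp, LieAlgebra.Symplectic.sp, mem_skewAdjointMatricesLieSubalgebra,
    mem_skewAdjointMatricesSubmodule, Matrix.IsSkewAdjoint, Matrix.IsAdjointPair, Matrix.J,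
    fromBlocks_transpose, fromBlocks_neg, fromBlocks_multiply, fromBlocks_multiply]
  simp only [fromBlocks_inj, Matrix.mul_zero, Matrix.mul_one, Matrix.zero_mul, Matrix.one_mul,
    Matrix.mul_neg, Matrix.neg_mul, add_zero, zero_add, neg_neg, neg_zero, neg_inj]
  constructor
  · rintro ⟨h1, h2, h3, h4⟩
    exact ⟨h2.symm, h4, h1⟩
  · rintro ⟨h1, h2, h3⟩
    subst h1
    simp [h2, h3]

/-- `𝔨' = {diag(X, -Xᵀ)}`. -/
def kLie (p : ℕ) : LieSubalgebra ℂ (sp p) where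
  carrier := {A | ∃ X : Matrix (Fin p) (Fin p) ℂ, A.1 = fromBlocks X 0 0 (-Xᵀ)}
  zero_mem' := ⟨0, by simp⟩
  add_mem' := by
    rintro A B ⟨X, hX⟩ ⟨Y, hY⟩
    exact ⟨X + Y, by simp [hX, hY, fromBlocks_add, add_comm]⟩
  smul_mem' := by
    rintro c A ⟨X, hX⟩
    exact ⟨c • X, by simp [hX, fromBlocks_smul]⟩
  lie_mem' := by
    rintro A B ⟨X, hX⟩ ⟨Y, hY⟩
    exact ⟨X * Y - Y * X, by
      rw [sp_bracket, hX, hY]; simp [fromBlocks_multiply, sub_eq_add_neg, fromBlocks_neg,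
        fromBlocks_add]⟩

/-- `𝔭⁺ = {(0 Y; 0 0) : Y = Yᵀ}`. -/
def pPlus (p : ℕ) : Submodule ℂ (sp p) where
  carrier := {A | ∃ Y : Matrix (Fin p) (Fin p) ℂ, Yᵀ = Y ∧ A.1 = fromBlocks 0 Y 0 0}
  zero_mem' := ⟨0, by simp, by simp⟩
  add_mem' := by
    rintro A B ⟨X, hX, hA⟩ ⟨Y, hY, hB⟩
    exact ⟨X + Y, by simp [hX, hY], by simp [hA, hB, fromBlocks_add]⟩
  smul_mem' := by
    rintro c A ⟨X, hX, hA⟩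
    exact ⟨c • X, by simp [hX], by simp [hA, fromBlocks_smul]⟩

/-- `𝔭⁻ = {(0 0; Z 0) : Z = Zᵀ}`. -/
def pMinus (p : ℕ) : Submodule ℂ (sp p) where
  carrier := {A | ∃ Z : Matrix (Fin p) (Fin p) ℂ, Zᵀ = Z ∧ A.1 = fromBlocks 0 0 Z 0}
  zero_mem' := ⟨0, by simp, by simp⟩
  add_mem' := by
    rintro A B ⟨X, hX, hA⟩ ⟨Y, hY, hB⟩
    exact ⟨X + Y, by simp [hX, hY], by simp [hA, hB, fromBlocks_add]⟩
  smul_mem' := by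
    rintro c A ⟨X, hX, hA⟩
    exact ⟨c • X, by simp [hX], by simp [hA, fromBlocks_smul]⟩

/-- `𝔭' = 𝔭⁺ + 𝔭⁻`. -/
def pPrime (p : ℕ) : Submodule ℂ (sp p) := pPlus p ⊔ pMinus p

theorem mem_pPrime_iff (A : sp p) : A ∈ pPrime p ↔
    ∃ Y Z : Matrix (Fin p) (Fin p) ℂ, Yᵀ = Y ∧ Zᵀ = Z ∧ A.1 = fromBlocks 0 Y Z 0 := by
  rw [pPrime, Submodule.mem_sup]
  constructor
  · rintro ⟨B, ⟨Y, hY, hB⟩, C, ⟨Z, hZ, hC⟩, rfl⟩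
    exact ⟨Y, Z, hY, hZ, by simp [hB, hC, fromBlocks_add]⟩
  · rintro ⟨Y, Z, hY, hZ, hA⟩
    exact ⟨⟨fromBlocks 0 Y 0 0, by simp [mem_sp_iff, hY]⟩, ⟨Y, hY, rfl⟩,
      ⟨fromBlocks 0 0 Z 0, by simp [mem_sp_iff, hZ]⟩, ⟨Z, hZ, rfl⟩,
      Subtype.ext (by simp [hA, fromBlocks_add])⟩

theorem mem_sup_pPlus_iff (A : sp p) : A ∈ (kLie p).toSubmodule ⊔ pPlus p ↔
    ∃ X Y : Matrix (Fin p) (Fin p) ℂ, Yᵀ = Y ∧ A.1 = fromBlocks X Y 0 (-Xᵀ) := by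
  rw [Submodule.mem_sup]
  constructor
  · rintro ⟨B, ⟨X, hB⟩, C, ⟨Y, hY, hC⟩, rfl⟩
    exact ⟨X, Y, hY, by simp [hB, hC, fromBlocks_add]⟩
  · rintro ⟨X, Y, hY, hA⟩
    exact ⟨⟨fromBlocks X 0 0 (-Xᵀ), by simp [mem_sp_iff]⟩, ⟨X, rfl⟩,
      ⟨fromBlocks 0 Y 0 0, by simp [mem_sp_iff, hY]⟩, ⟨Y, hY, rfl⟩,
      Subtype.ext (by simp [hA, fromBlocks_add])⟩

theorem mem_sup_pMinus_iff (A : sp p) : A ∈ (kLie p).toSubmodule ⊔ pMinus p ↔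
    ∃ X Z : Matrix (Fin p) (Fin p) ℂ, Zᵀ = Z ∧ A.1 = fromBlocks X 0 Z (-Xᵀ) := by
  rw [Submodule.mem_sup]
  constructor
  · rintro ⟨B, ⟨X, hB⟩, C, ⟨Y, hY, hC⟩, rfl⟩
    exact ⟨X, Y, hY, by simp [hB, hC, fromBlocks_add]⟩
  · rintro ⟨X, Y, hY, hA⟩
    exact ⟨⟨fromBlocks X 0 0 (-Xᵀ), by simp [mem_sp_iff]⟩, ⟨X, rfl⟩,
      ⟨fromBlocks 0 0 Y 0, by simp [mem_sp_iff, hY]⟩, ⟨Y, hY, rfl⟩,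
      Subtype.ext (by simp [hA, fromBlocks_add])⟩

/-- The parabolic subalgebra `𝔮⁺ = 𝔨' + 𝔭⁺`. -/
def qPlus (p : ℕ) : LieSubalgebra ℂ (sp p) where
  toSubmodule := (kLie p).toSubmodule ⊔ pPlus p
  lie_mem' := by
    intro A B hA hB
    change A ∈ (kLie p).toSubmodule ⊔ pPlus p at hA
    change B ∈ (kLie p).toSubmodule ⊔ pPlus p at hB
    change ⁅A, B⁆ ∈ (kLie p).toSubmodule ⊔ pPlus p
    rw [mem_sup_pPlus_iff] at hA hB ⊢
    obtain ⟨X, Y, hY, hA⟩ := hA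
    obtain ⟨X', Y', hY', hB⟩ := hB
    refine ⟨X * X' - X' * X, X * Y' - Y * X'ᵀ - (X' * Y - Y' * Xᵀ), ?_, ?_⟩
    · simp [hY, hY']; abel
    · rw [sp_bracket, hA, hB]
      simp [fromBlocks_multiply, sub_eq_add_neg, fromBlocks_neg, fromBlocks_add]

/-- The parabolic subalgebra `𝔮⁻ = 𝔨' + 𝔭⁻`. -/
def qMinus (p : ℕ) : LieSubalgebra ℂ (sp p) where
  toSubmodule := (kLie p).toSubmodule ⊔ pMinus p
  lie_mem' := by
    intro A B hA hB
    change A ∈ (kLie p).toSubmodule ⊔ pMinus p at hA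
    change B ∈ (kLie p).toSubmodule ⊔ pMinus p at hB
    change ⁅A, B⁆ ∈ (kLie p).toSubmodule ⊔ pMinus p
    rw [mem_sup_pMinus_iff] at hA hB ⊢
    obtain ⟨X, Y, hY, hA⟩ := hA
    obtain ⟨X', Y', hY', hB⟩ := hB
    refine ⟨X * X' - X' * X, Y * X' - Xᵀ * Y' - (Y' * X - X'ᵀ * Y), ?_, ?_⟩
    · simp [hY, hY']; abel
    · rw [sp_bracket, hA, hB]
      simp [fromBlocks_multiply, sub_eq_add_neg, fromBlocks_neg, fromBlocks_add]

/-- The projection `𝔤' = 𝔨' ⊕ 𝔭' → 𝔨'`. -/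
def kProj (p : ℕ) : sp p →ₗ[ℂ] kLie p where
  toFun A := ⟨⟨fromBlocks A.1.toBlocks₁₁ 0 0 (-A.1.toBlocks₁₁ᵀ), by simp [mem_sp_iff]⟩, ⟨_, rfl⟩⟩
  map_add' A B := by
    apply Subtype.ext; apply Subtype.ext
    change fromBlocks (A.1 + B.1).toBlocks₁₁ 0 0 (-(A.1 + B.1).toBlocks₁₁ᵀ) =
      fromBlocks A.1.toBlocks₁₁ 0 0 (-A.1.toBlocks₁₁ᵀ) +
        fromBlocks B.1.toBlocks₁₁ 0 0 (-B.1.toBlocks₁₁ᵀ)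
    have h : (A.1 + B.1).toBlocks₁₁ = A.1.toBlocks₁₁ + B.1.toBlocks₁₁ := rfl
    rw [h, fromBlocks_add]
    simp [add_comm]
  map_smul' c A := by
    apply Subtype.ext; apply Subtype.ext
    change fromBlocks (c • A.1).toBlocks₁₁ 0 0 (-(c • A.1).toBlocks₁₁ᵀ) =
      c • fromBlocks A.1.toBlocks₁₁ 0 0 (-A.1.toBlocks₁₁ᵀ)
    have h : (c • A.1).toBlocks₁₁ = c • A.1.toBlocks₁₁ := rfl
    rw [h, fromBlocks_smul]
    simp

theorem kProj_val (A : sp p) {X Y Z W : Matrix (Fin p) (Fin p) ℂ}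
    (h : A.1 = fromBlocks X Y Z W) : (kProj p A).1.1 = fromBlocks X 0 0 (-Xᵀ) := by
  change fromBlocks A.1.toBlocks₁₁ 0 0 (-A.1.toBlocks₁₁ᵀ) = _
  rw [h, toBlocks_fromBlocks₁₁]

theorem kProj_k (A : kLie p) : kProj p A.1 = A := by
  obtain ⟨X, hX⟩ := A.2
  apply Subtype.ext; apply Subtype.ext
  rw [kProj_val _ hX, hX]

theorem kProj_pPrime {A : sp p} (hA : A ∈ pPrime p) : kProj p A = 0 := by
  obtain ⟨Y, Z, -, -, h⟩ := (mem_pPrime_iff A).1 hA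
  apply Subtype.ext; apply Subtype.ext
  rw [kProj_val _ h]
  simp

/-- The Lie algebra homomorphism `𝔮⁺ → 𝔨'` that is the identity on `𝔨'` and kills `𝔭⁺`. -/
def qPlusProj (p : ℕ) : qPlus p →ₗ⁅ℂ⁆ kLie p :=
  { (kProj p).comp (qPlus p).toSubmodule.subtype with
    map_lie' := by
      intro A B
      obtain ⟨X, Y, -, hA⟩ := (mem_sup_pPlus_iff A.1).1 A.2
      obtain ⟨X', Y', -, hB⟩ := (mem_sup_pPlus_iff B.1).1 B.2
      apply Subtype.ext; apply Subtype.ext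
      change (kProj p ⁅A.1, B.1⁆).1.1 =
        (kProj p A.1).1.1 * (kProj p B.1).1.1 - (kProj p B.1).1.1 * (kProj p A.1).1.1
      have h : (⁅A.1, B.1⁆ : sp p).1 = fromBlocks (X * X' - X' * X)
          (X * Y' - Y * X'ᵀ - (X' * Y - Y' * Xᵀ)) 0 (Xᵀ * X'ᵀ - X'ᵀ * Xᵀ) := by
        rw [sp_bracket, hA, hB]
        simp [fromBlocks_multiply, sub_eq_add_neg, fromBlocks_neg, fromBlocks_add]
      rw [kProj_val _ h, kProj_val _ hA, kProj_val _ hB]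
      simp [fromBlocks_multiply, sub_eq_add_neg, fromBlocks_neg, fromBlocks_add] }

/-- The Lie algebra homomorphism `𝔮⁻ → 𝔨'` that is the identity on `𝔨'` and kills `𝔭⁻`. -/
def qMinusProj (p : ℕ) : qMinus p →ₗ⁅ℂ⁆ kLie p :=
  { (kProj p).comp (qMinus p).toSubmodule.subtype with
    map_lie' := by
      intro A B
      obtain ⟨X, Y, -, hA⟩ := (mem_sup_pMinus_iff A.1).1 A.2
      obtain ⟨X', Y', -, hB⟩ := (mem_sup_pMinus_iff B.1).1 B.2
      apply Subtype.ext; apply Subtype.ext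
      change (kProj p ⁅A.1, B.1⁆).1.1 =
        (kProj p A.1).1.1 * (kProj p B.1).1.1 - (kProj p B.1).1.1 * (kProj p A.1).1.1
      have h : (⁅A.1, B.1⁆ : sp p).1 = fromBlocks (X * X' - X' * X) 0
          (Y * X' - Xᵀ * Y' - (Y' * X - X'ᵀ * Y)) (Xᵀ * X'ᵀ - X'ᵀ * Xᵀ) := by
        rw [sp_bracket, hA, hB]
        simp [fromBlocks_multiply, sub_eq_add_neg, fromBlocks_neg, fromBlocks_add]
      rw [kProj_val _ h, kProj_val _ hA, kProj_val _ hB]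
      simp [fromBlocks_multiply, sub_eq_add_neg, fromBlocks_neg, fromBlocks_add] }

/-! Bracket relations. -/

theorem k_pPlus {A B : sp p} (hA : A ∈ kLie p) (hB : B ∈ pPlus p) : ⁅A, B⁆ ∈ pPlus p := by
  obtain ⟨X, hA⟩ := hA
  obtain ⟨Y, hY, hB⟩ := hB
  refine ⟨X * Y + Y * Xᵀ, by simp [hY, add_comm], ?_⟩
  rw [sp_bracket, hA, hB]
  simp [fromBlocks_multiply, sub_eq_add_neg, fromBlocks_neg, fromBlocks_add]

theorem k_pMinus {A B : sp p} (hA : A ∈ kLie p) (hB : B ∈ pMinus p) : ⁅A, B⁆ ∈ pMinus p := by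
  obtain ⟨X, hA⟩ := hA
  obtain ⟨Y, hY, hB⟩ := hB
  refine ⟨-(Xᵀ * Y) - Y * X, by simp [hY, sub_eq_add_neg, add_comm], ?_⟩
  rw [sp_bracket, hA, hB]
  simp [fromBlocks_multiply, sub_eq_add_neg, fromBlocks_neg, fromBlocks_add]

theorem pPlus_pMinus {A B : sp p} (hA : A ∈ pPlus p) (hB : B ∈ pMinus p) : ⁅A, B⁆ ∈ kLie p := by
  obtain ⟨Y, hY, hA⟩ := hA
  obtain ⟨Z, hZ, hB⟩ := hB
  refine ⟨Y * Z, ?_⟩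
  rw [sp_bracket, hA, hB]
  simp [fromBlocks_multiply, sub_eq_add_neg, fromBlocks_neg, fromBlocks_add, hY, hZ]

theorem pPrime_pPrime {A B : sp p} (hA : A ∈ pPrime p) (hB : B ∈ pPrime p) :
    ⁅A, B⁆ ∈ kLie p := by
  obtain ⟨Y, Z, hY, hZ, hA⟩ := (mem_pPrime_iff A).1 hA
  obtain ⟨Y', Z', hY', hZ', hB⟩ := (mem_pPrime_iff B).1 hB
  refine ⟨Y * Z' - Y' * Z, ?_⟩
  rw [sp_bracket, hA, hB]
  simp [fromBlocks_multiply, sub_eq_add_neg, fromBlocks_neg, fromBlocks_add, hY, hZ, hY', hZ',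
    add_comm]

end Blocks

/-! ### Filtrations by degree in `𝔭'` -/

section Filtration

/-- A filtration of a `U(𝔤')`-module, indexed by `ℕ`, that is compatible with the filtration of
`U(𝔤')` in which `𝔨'` has degree `0` and `𝔭'` has degree `1`. -/
structure CartanFiltration (p : ℕ) (W : Type*) [AddCommGroup W] [Module ℂ W]
    [Module (U (sp p)) W] where
  F : ℕ → Submodule ℂ W
  mono : ∀ n, F n ≤ F (n + 1)
  k_smul : ∀ x ∈ kLie p, ∀ n, ∀ v ∈ F n, ιU (sp p) x • v ∈ F n
  p_smul : ∀ x ∈ pPrime p, ∀ n, ∀ v ∈ F n, ιU (sp p) x • v ∈ F (n + 1)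

open scoped IsMulCommutative in
/-- An action of the symmetric algebra from a family of commuting endomorphisms. -/
def symAct {R M N : Type*} [CommRing R] [AddCommGroup M] [Module R M] [AddCommGroup N] [Module R N]
    (f : M →ₗ[R] Module.End R N) (hf : ∀ x y, f x * f y = f y * f x) :
    SymmetricAlgebra R M →ₐ[R] Module.End R N :=
  have : IsMulCommutative (Algebra.adjoin R (Set.range f)) := Algebra.isMulCommutative_adjoin R (by
    rintro _ ⟨x, rfl⟩ _ ⟨y, rfl⟩
    exact hf x y)
  (Algebra.adjoin R (Set.range f)).val.comp
    (SymmetricAlgebra.lift (f.codRestrict (Subalgebra.toSubmodule (Algebra.adjoin R (Set.range f)))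
      fun x => Algebra.subset_adjoin ⟨x, rfl⟩))

open scoped IsMulCommutative in
theorem symAct_ι {R M N : Type*} [CommRing R] [AddCommGroup M] [Module R M] [AddCommGroup N]
    [Module R N] (f : M →ₗ[R] Module.End R N) (hf : ∀ x y, f x * f y = f y * f x) (x : M) :
    symAct f hf (SymmetricAlgebra.ι R M x) = f x := by
  have : IsMulCommutative (Algebra.adjoin R (Set.range f)) := Algebra.isMulCommutative_adjoin R (by
    rintro _ ⟨x, rfl⟩ _ ⟨y, rfl⟩
    exact hf x y)
  change ((SymmetricAlgebra.lift
    (f.codRestrict (Subalgebra.toSubmodule (Algebra.adjoin R (Set.range f)))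
      fun x => Algebra.subset_adjoin ⟨x, rfl⟩) (SymmetricAlgebra.ι R M x) :
        Algebra.adjoin R (Set.range f)) : Module.End R N) = f x
  rw [SymmetricAlgebra.lift_ι_apply]
  rfl

namespace CartanFiltration

variable {p : ℕ} {W W' : Type*} [AddCommGroup W] [Module ℂ W] [Module (U (sp p)) W]
  [IsScalarTower ℂ (U (sp p)) W] [AddCommGroup W'] [Module ℂ W'] [Module (U (sp p)) W']
  [IsScalarTower ℂ (U (sp p)) W']

/-- `F (n - 1)`, with `F (-1) = 0`. -/
def prev (Φ : CartanFiltration p W) : ℕ → Submodule ℂ W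
  | 0 => ⊥
  | n + 1 => Φ.F n

theorem prev_le (Φ : CartanFiltration p W) : ∀ n, Φ.prev n ≤ Φ.F n
  | 0 => bot_le
  | n + 1 => Φ.mono n

theorem prev_p_smul (Φ : CartanFiltration p W) {x : sp p} (hx : x ∈ pPrime p) :
    ∀ n, ∀ v ∈ Φ.prev n, ιU (sp p) x • v ∈ Φ.F n
  | 0, v, hv => by
    rw [(Submodule.mem_bot ℂ).1 hv, smul_zero]; exact zero_mem _
  | n + 1, v, hv => Φ.p_smul x hx n v hv

/-- The graded piece `F n / F (n - 1)`. -/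
abbrev piece (Φ : CartanFiltration p W) (n : ℕ) : Type _ :=
  Φ.F n ⧸ (Φ.prev n).submoduleOf (Φ.F n)

/-- The class in `F n / F (n - 1)` of an element of `F n`. -/
abbrev cls (Φ : CartanFiltration p W) (n : ℕ) : Φ.F n →ₗ[ℂ] Φ.piece n :=
  ((Φ.prev n).submoduleOf (Φ.F n)).mkQ

/-- The associated graded space `⨁ n, F n / F (n - 1)`. -/
def Gr (Φ : CartanFiltration p W) : Type _ := ⨁ n, Φ.piece n

instance (Φ : CartanFiltration p W) : AddCommGroup Φ.Gr :=
  inferInstanceAs (AddCommGroup (⨁ n, Φ.piece n))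

instance (Φ : CartanFiltration p W) : Module ℂ Φ.Gr :=
  inferInstanceAs (Module ℂ (⨁ n, Φ.piece n))

/-- The inclusion of the `n`-th graded piece. -/
def incl (Φ : CartanFiltration p W) (n : ℕ) : Φ.piece n →ₗ[ℂ] Φ.Gr :=
  DirectSum.lof ℂ ℕ Φ.piece n

theorem Gr.hom_ext {Φ : CartanFiltration p W} {N : Type*} [AddCommGroup N] [Module ℂ N]
    {f g : Φ.Gr →ₗ[ℂ] N}
    (h : ∀ n (v : Φ.F n), f (Φ.incl n (Φ.cls n v)) = g (Φ.incl n (Φ.cls n v))) : f = g := by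
  apply DirectSum.linearMap_ext
  intro n
  apply Submodule.linearMap_qext
  ext v
  exact h n v

/-- The action of `x ∈ 𝔭'`, as a map `F n → F (n + 1)`. -/
def pMap (Φ : CartanFiltration p W) (x : pPrime p) (n : ℕ) : Φ.F n →ₗ[ℂ] Φ.F (n + 1) :=
  ((Algebra.lsmul ℂ ℂ W (ιU (sp p) x.1)).comp (Φ.F n).subtype).codRestrict _
    fun v => Φ.p_smul x.1 x.2 n v.1 v.2

/-- The map `F n / F (n - 1) → F (n + 1) / F n`, `[v] ↦ [x v]`, for `x ∈ 𝔭'`. -/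
def pPiece (Φ : CartanFiltration p W) (x : pPrime p) (n : ℕ) : Φ.piece n →ₗ[ℂ] Φ.piece (n + 1) :=
  Submodule.mapQ _ _ (Φ.pMap x n) fun v hv => Φ.prev_p_smul x.2 n v.1 hv

/-- The action of `x ∈ 𝔭'` on the associated graded space. -/
def pEnd (Φ : CartanFiltration p W) (x : pPrime p) : Module.End ℂ Φ.Gr :=
  DirectSum.toModule ℂ ℕ Φ.Gr fun n => (Φ.incl (n + 1)).comp (Φ.pPiece x n)

theorem pEnd_incl (Φ : CartanFiltration p W) (x : pPrime p) (n : ℕ) (v : Φ.F n) :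
    Φ.pEnd x (Φ.incl n (Φ.cls n v)) = Φ.incl (n + 1) (Φ.cls (n + 1) (Φ.pMap x n v)) :=
  DirectSum.toModule_lof ..

/-- The action of `𝔭'` on the associated graded space, as a linear map. -/
def pEndL (Φ : CartanFiltration p W) : pPrime p →ₗ[ℂ] Module.End ℂ Φ.Gr where
  toFun := Φ.pEnd
  map_add' x y := by
    apply Gr.hom_ext
    intro n v
    rw [LinearMap.add_apply, pEnd_incl, pEnd_incl, pEnd_incl, ← map_add, ← map_add]
    congr 2
    apply Subtype.ext
    change ιU (sp p) (x.1 + y.1) • v.1 = ιU (sp p) x.1 • v.1 + ιU (sp p) y.1 • v.1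
    rw [map_add, add_smul]
  map_smul' c x := by
    apply Gr.hom_ext
    intro n v
    rw [RingHom.id_apply, LinearMap.smul_apply, pEnd_incl, pEnd_incl, ← map_smul, ← map_smul]
    congr 2
    apply Subtype.ext
    change ιU (sp p) (c • x.1) • v.1 = c • ιU (sp p) x.1 • v.1
    rw [map_smul, smul_assoc]

theorem pEndL_apply (Φ : CartanFiltration p W) (x : pPrime p) : Φ.pEndL x = Φ.pEnd x := rfl

theorem pEndL_comm (Φ : CartanFiltration p W) (x y : pPrime p) :
    Φ.pEndL x * Φ.pEndL y = Φ.pEndL y * Φ.pEndL x := by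
  apply Gr.hom_ext
  intro n v
  rw [Module.End.mul_apply, Module.End.mul_apply, pEndL_apply, pEndL_apply, pEnd_incl, pEnd_incl, pEnd_incl, pEnd_incl]
  congr 1
  refine (Submodule.Quotient.eq _).2 ?_
  change ιU (sp p) x.1 • ιU (sp p) y.1 • v.1 - ιU (sp p) y.1 • ιU (sp p) x.1 • v.1 ∈ Φ.F (n + 1)
  have h : ιU (sp p) x.1 • ιU (sp p) y.1 • v.1 - ιU (sp p) y.1 • ιU (sp p) x.1 • v.1 =
      ιU (sp p) ⁅x.1, y.1⁆ • v.1 := by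
    rw [ιU_lie, sub_smul, mul_smul, mul_smul]
  rw [h]
  exact Φ.mono n (Φ.k_smul _ (pPrime_pPrime x.2 y.2) n v.1 v.2)

/-- The `S(𝔭')`-module structure of the associated graded space. -/
instance (Φ : CartanFiltration p W) : Module (SymmetricAlgebra ℂ (pPrime p)) Φ.Gr :=
  Module.compHom Φ.Gr (symAct Φ.pEndL Φ.pEndL_comm).toRingHom

theorem ι_smul_incl (Φ : CartanFiltration p W) (x : pPrime p) (n : ℕ) (v : Φ.F n) :
    SymmetricAlgebra.ι ℂ (pPrime p) x • Φ.incl n (Φ.cls n v) =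
      Φ.incl (n + 1) (Φ.cls (n + 1) (Φ.pMap x n v)) := by
  change symAct Φ.pEndL Φ.pEndL_comm (SymmetricAlgebra.ι ℂ (pPrime p) x) _ = _
  rw [symAct_ι]
  exact Φ.pEnd_incl x n v

/-- A `U(𝔤')`-linear map preserves the filtrations. -/
def Preserves (Φ : CartanFiltration p W) (Ψ : CartanFiltration p W') (T : W →ₗ[U (sp p)] W') :
    Prop := ∀ n, ∀ v ∈ Φ.F n, T v ∈ Ψ.F n

section grMap

variable {Φ : CartanFiltration p W} {Ψ : CartanFiltration p W'} {T : W →ₗ[U (sp p)] W'}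

theorem Preserves.prev (hT : Preserves Φ Ψ T) : ∀ n, ∀ v ∈ Φ.prev n, T v ∈ Ψ.prev n
  | 0, v, hv => by rw [(Submodule.mem_bot ℂ).1 hv, map_zero]; exact zero_mem _
  | n + 1, v, hv => hT n v hv

/-- The restriction `F n → F' n`. -/
def Preserves.restr (hT : Preserves Φ Ψ T) (n : ℕ) : Φ.F n →ₗ[ℂ] Ψ.F n :=
  ((T.restrictScalars ℂ).comp (Φ.F n).subtype).codRestrict _ fun v => hT n v.1 v.2

/-- The map induced on graded spaces, as a `ℂ`-linear map. -/
def Preserves.grMapAux (hT : Preserves Φ Ψ T) : Φ.Gr →ₗ[ℂ] Ψ.Gr :=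
  DirectSum.toModule ℂ ℕ Ψ.Gr fun n => (Ψ.incl n).comp
    (Submodule.mapQ _ _ (hT.restr n) fun v hv => hT.prev n v.1 hv)

theorem Preserves.grMapAux_incl (hT : Preserves Φ Ψ T) (n : ℕ) (v : Φ.F n) :
    hT.grMapAux (Φ.incl n (Φ.cls n v)) = Ψ.incl n (Ψ.cls n (hT.restr n v)) :=
  DirectSum.toModule_lof ..

/-- The `S(𝔭')`-linear map `Gr T : [v] ↦ [T v]` induced on graded spaces by a `U(𝔤')`-linear map
that preserves the filtrations. -/
def Preserves.grMap (hT : Preserves Φ Ψ T) : Φ.Gr →ₗ[SymmetricAlgebra ℂ (pPrime p)] Ψ.Gr where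
  toFun := hT.grMapAux
  map_add' := map_add _
  map_smul' s v := by
    change hT.grMapAux (symAct Φ.pEndL Φ.pEndL_comm s v) =
      symAct Ψ.pEndL Ψ.pEndL_comm s (hT.grMapAux v)
    induction s using SymmetricAlgebra.induction generalizing v with
    | algebraMap r => simp [Module.algebraMap_end_apply]
    | mul a b ha hb => rw [map_mul, map_mul, Module.End.mul_apply, Module.End.mul_apply, ha, hb]
    | add a b ha hb => rw [map_add, map_add, LinearMap.add_apply, LinearMap.add_apply, map_add,
        ha, hb]
    | ι x =>
      rw [symAct_ι, symAct_ι]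
      suffices h : hT.grMapAux.comp (Φ.pEndL x) = (Ψ.pEndL x).comp hT.grMapAux from
        LinearMap.congr_fun h v
      apply Gr.hom_ext
      intro n w
      rw [LinearMap.comp_apply, LinearMap.comp_apply, pEndL_apply, pEndL_apply, pEnd_incl, Preserves.grMapAux_incl, Preserves.grMapAux_incl, pEnd_incl]
      congr 2
      apply Subtype.ext
      exact T.map_smul _ _

end grMap

end CartanFiltration

/-! The filtration of `U(𝔤')`. -/

section UFil

variable (p : ℕ)

/-- The image of a subspace of `𝔤'` in `U(𝔤')`. -/
abbrev imU {p : ℕ} (S : Submodule ℂ (sp p)) : Submodule ℂ (U (sp p)) :=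
  S.map (ιU (sp p))

/-- The algebra homomorphism `U(𝔨') → U(𝔤')`. -/
abbrev kToG : U (kLie p) →ₐ[ℂ] U (sp p) := envMap (kLie p).incl

/-- The image of `U(𝔨')` in `U(𝔤')`. -/
def Uk : Submodule ℂ (U (sp p)) := Subalgebra.toSubmodule (kToG p).range

/-- `M n`, the span of all products `α₁ ⋯ α_r β₁ ⋯ β_s` in `U(𝔤')` with `αᵢ ∈ 𝔭⁻`, `βⱼ ∈ 𝔭⁺` and
`r + s ≤ n`. -/
def M (n : ℕ) : Submodule ℂ (U (sp p)) :=
  ⨆ (r : ℕ) (s : ℕ) (_ : r + s ≤ n), imU (pMinus p) ^ r * imU (pPlus p) ^ s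

theorem mul_le_mul_l {A : Type*} [Ring A] [Algebra ℂ A] {S S' T : Submodule ℂ A} (h : S ≤ S') :
    S * T ≤ S' * T := mul_le_mul' h le_rfl

theorem mul_le_mul_r {A : Type*} [Ring A] [Algebra ℂ A] {S T T' : Submodule ℂ A} (h : T ≤ T') :
    S * T ≤ S * T' := mul_le_mul' le_rfl h

theorem comm_aux {S P Q : Submodule ℂ (sp p)} (h : ∀ x ∈ S, ∀ y ∈ P, ⁅x, y⁆ ∈ Q) :
    imU S * imU P ≤ imU P * imU S ⊔ imU Q := by
  refine Submodule.mul_le.2 ?_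
  rintro _ ⟨x, hx, rfl⟩ _ ⟨y, hy, rfl⟩
  change ιU (sp p) x * ιU (sp p) y ∈ _
  have e : ιU (sp p) x * ιU (sp p) y = ιU (sp p) y * ιU (sp p) x + ιU (sp p) ⁅x, y⁆ := by
    rw [ιU_lie]; abel
  rw [e]
  exact Submodule.add_mem_sup (Submodule.mul_mem_mul ⟨y, hy, rfl⟩ ⟨x, hx, rfl⟩) ⟨_, h x hx y hy, rfl⟩

theorem k_pow {P : Submodule ℂ (sp p)} (h : ∀ x ∈ (kLie p).toSubmodule, ∀ y ∈ P, ⁅x, y⁆ ∈ P)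
    (r : ℕ) : imU (kLie p).toSubmodule * imU P ^ r ≤ imU P ^ r * (imU (kLie p).toSubmodule ⊔ 1) := by
  induction r with
  | zero => simp
  | succ r ih =>
    calc imU (kLie p).toSubmodule * imU P ^ (r + 1)
        = imU (kLie p).toSubmodule * imU P * imU P ^ r := by rw [pow_succ', mul_assoc]
      _ ≤ (imU P * imU (kLie p).toSubmodule ⊔ imU P) * imU P ^ r :=
          mul_le_mul_l (comm_aux p h)
      _ = imU P * (imU (kLie p).toSubmodule * imU P ^ r) ⊔ imU P ^ (r + 1) := by
          rw [Submodule.sup_mul, mul_assoc, pow_succ']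
      _ ≤ imU P * (imU P ^ r * (imU (kLie p).toSubmodule ⊔ 1)) ⊔ imU P ^ (r + 1) :=
          sup_le_sup_right (mul_le_mul_r ih) _
      _ = imU P ^ (r + 1) * (imU (kLie p).toSubmodule ⊔ 1) := by
          rw [← mul_assoc, ← pow_succ', sup_eq_left, Submodule.mul_sup, mul_one]
          exact le_sup_right

theorem k_mul_Uk : imU (kLie p).toSubmodule * Uk p ≤ Uk p := by
  refine Submodule.mul_le.2 ?_
  rintro _ ⟨x, hx, rfl⟩ u hu
  exact (kToG p).range.mul_mem ⟨ιU (kLie p) ⟨x, hx⟩, envMap_ι _ _⟩ hu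

theorem plus_pow (r : ℕ) : imU (pPlus p) * imU (pMinus p) ^ (r + 1) ≤
    imU (pMinus p) ^ (r + 1) * imU (pPlus p) ⊔
      imU (pMinus p) ^ r * (imU (kLie p).toSubmodule ⊔ 1) := by
  have h0 := comm_aux p (S := pPlus p) (P := pMinus p) (Q := (kLie p).toSubmodule)
    fun x hx y hy => pPlus_pMinus hx hy
  induction r with
  | zero =>
    rw [zero_add, pow_one, pow_zero, one_mul]
    exact h0.trans (sup_le_sup_left le_sup_left _)
  | succ r ih =>
    calc imU (pPlus p) * imU (pMinus p) ^ (r + 1 + 1)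
        = imU (pPlus p) * imU (pMinus p) * imU (pMinus p) ^ (r + 1) := by
          rw [pow_succ' _ (r + 1), mul_assoc]
      _ ≤ (imU (pMinus p) * imU (pPlus p) ⊔ imU (kLie p).toSubmodule) * imU (pMinus p) ^ (r + 1) :=
          mul_le_mul_l h0
      _ = imU (pMinus p) * (imU (pPlus p) * imU (pMinus p) ^ (r + 1)) ⊔
            imU (kLie p).toSubmodule * imU (pMinus p) ^ (r + 1) := by
          rw [Submodule.sup_mul, mul_assoc]
      _ ≤ imU (pMinus p) * (imU (pMinus p) ^ (r + 1) * imU (pPlus p) ⊔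
            imU (pMinus p) ^ r * (imU (kLie p).toSubmodule ⊔ 1)) ⊔
            imU (pMinus p) ^ (r + 1) * (imU (kLie p).toSubmodule ⊔ 1) :=
          sup_le_sup (mul_le_mul_r ih) (k_pow p (fun x hx y hy => k_pMinus hx hy) _)
      _ = _ := by
          rw [Submodule.mul_sup, ← mul_assoc, ← mul_assoc, ← pow_succ', ← pow_succ', sup_assoc,
            sup_idem]

/-- The subspace `S(𝔭⁻)[r] S(𝔭⁺)[s] U(𝔨')` of `U(𝔤')`. -/
def N (r s : ℕ) : Submodule ℂ (U (sp p)) :=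
  imU (pMinus p) ^ r * (imU (pPlus p) ^ s * Uk p)

theorem M_mul_Uk (n : ℕ) : M p n * Uk p = ⨆ (r : ℕ) (s : ℕ) (_ : r + s ≤ n), N p r s := by
  simp only [M, N, Submodule.iSup_mul, mul_assoc]

theorem k_mul_pUk (s : ℕ) : imU (kLie p).toSubmodule * (imU (pPlus p) ^ s * Uk p) ≤
    imU (pPlus p) ^ s * Uk p := by
  rw [← mul_assoc]
  refine (mul_le_mul_l (k_pow p (fun x hx y hy => k_pPlus hx hy) s)).trans ?_
  rw [mul_assoc]
  refine mul_le_mul_r ?_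
  rw [Submodule.sup_mul, one_mul]
  exact sup_le (k_mul_Uk p) le_rfl

theorem kone_mul_pUk (s : ℕ) : (imU (kLie p).toSubmodule ⊔ 1) * (imU (pPlus p) ^ s * Uk p) ≤
    imU (pPlus p) ^ s * Uk p := by
  rw [Submodule.sup_mul, one_mul]
  exact sup_le (k_mul_pUk p s) le_rfl

theorem k_mul_N (r s : ℕ) : imU (kLie p).toSubmodule * N p r s ≤ N p r s := by
  rw [N, ← mul_assoc]
  refine (mul_le_mul_l (k_pow p (fun x hx y hy => k_pMinus hx hy) r)).trans ?_
  rw [mul_assoc]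
  exact mul_le_mul_r (kone_mul_pUk p s)

theorem minus_mul_N (r s : ℕ) : imU (pMinus p) * N p r s = N p (r + 1) s := by
  rw [N, N, ← mul_assoc, ← pow_succ']

theorem plus_mul_N (r s : ℕ) : imU (pPlus p) * N p r s ≤ N p r (s + 1) ⊔ N p (r - 1) s := by
  cases r with
  | zero =>
    refine le_sup_of_le_left ?_
    rw [N, N, pow_zero, one_mul, one_mul, ← mul_assoc, ← pow_succ']
  | succ r =>
    rw [N, ← mul_assoc]
    refine (mul_le_mul_l (plus_pow p r)).trans ?_
    rw [Submodule.sup_mul, mul_assoc, mul_assoc]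
    refine sup_le_sup ?_ (mul_le_mul_r (kone_mul_pUk p s))
    rw [N, pow_succ' (imU (pPlus p)) s, mul_assoc]

theorem N_le {r s n : ℕ} (h : r + s ≤ n) : N p r s ≤ M p n * Uk p := by
  rw [M_mul_Uk]
  exact le_iSup_of_le r (le_iSup_of_le s (le_iSup_of_le h le_rfl))

theorem k_mul_M (n : ℕ) : imU (kLie p).toSubmodule * (M p n * Uk p) ≤ M p n * Uk p := by
  conv_lhs => rw [M_mul_Uk]
  simp only [Submodule.mul_iSup]
  exact iSup_le fun r => iSup_le fun s => iSup_le fun h => (k_mul_N p r s).trans (N_le p h)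

theorem p_mul_M (n : ℕ) : imU (pPrime p) * (M p n * Uk p) ≤ M p (n + 1) * Uk p := by
  rw [M_mul_Uk p n, pPrime, imU, Submodule.map_sup]
  simp only [Submodule.mul_iSup]
  refine iSup_le fun r => iSup_le fun s => iSup_le fun h => ?_
  rw [Submodule.sup_mul]
  refine sup_le ((plus_mul_N p r s).trans (sup_le (N_le p ?_) (N_le p ?_)))
    ((minus_mul_N p r s).le.trans (N_le p ?_)) <;> omega

theorem M_mono (n : ℕ) : M p n * Uk p ≤ M p (n + 1) * Uk p := by
  rw [M_mul_Uk]
  refine iSup_le fun r => iSup_le fun s => iSup_le fun h => N_le p (by omega)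

end UFil

/-- The filtration of `U(𝔤') ⊗_A X` by the images of `(M n U(𝔨')) ⊗ X`. -/
def inducedFil {p : ℕ} {A X : Type*} [Ring A] [Algebra ℂ A] [AddCommGroup X] [Module ℂ X]
    (φ : A →ₐ[ℂ] U (sp p)) (ρ : A →ₐ[ℂ] Module.End ℂ X) : CartanFiltration p (Induced φ ρ) where
  F n := Submodule.map₂ (Induced.mk φ ρ) (M p n * Uk p) ⊤
  mono n := Submodule.map₂_le_map₂_left (M_mono p n)
  k_smul x hx n _ hv := Induced.smul_mem_map₂ φ ρ
    (fun _ hu => k_mul_M p n (Submodule.mul_mem_mul ⟨x, hx, rfl⟩ hu)) hv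
  p_smul x hx n _ hv := Induced.smul_mem_map₂ φ ρ
    (fun _ hu => p_mul_M p n (Submodule.mul_mem_mul ⟨x, hx, rfl⟩ hu)) hv

/-- The filtration `(X ⊗ Y)_n = ∑_{r + s ≤ n} X_r ⊗ Y_s` of the tensor product of two filtered
modules. -/
def tensorFil {p : ℕ} {A A' X Y : Type*} [Ring A] [Algebra ℂ A] [AddCommGroup X] [Module ℂ X]
    [Ring A'] [Algebra ℂ A'] [AddCommGroup Y] [Module ℂ Y]
    {φ : A →ₐ[ℂ] U (sp p)} {ρ : A →ₐ[ℂ] Module.End ℂ X}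
    {φ' : A' →ₐ[ℂ] U (sp p)} {ρ' : A' →ₐ[ℂ] Module.End ℂ Y}
    (Φ : CartanFiltration p (Induced φ ρ)) (Ψ : CartanFiltration p (Induced φ' ρ')) :
    CartanFiltration p (DiagTensor (sp p) (Induced φ ρ) (Induced φ' ρ')) where
  F n := ⨆ (r : ℕ) (s : ℕ) (_ : r + s ≤ n),
    Submodule.map₂ (DiagTensor.mk (sp p) (Induced φ ρ) (Induced φ' ρ')) (Φ.F r) (Ψ.F s)
  mono n := iSup_le fun r => iSup_le fun s => iSup_le fun h =>
    le_iSup_of_le r (le_iSup_of_le s (le_iSup_of_le (by omega) le_rfl))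
  k_smul x hx n t ht := by
    set G := ⨆ (r : ℕ) (s : ℕ) (_ : r + s ≤ n),
      Submodule.map₂ (DiagTensor.mk (sp p) (Induced φ ρ) (Induced φ' ρ')) (Φ.F r) (Ψ.F s) with hG
    have hle : ∀ r s, r + s ≤ n → ∀ v ∈ Φ.F r, ∀ w ∈ Ψ.F s,
        DiagTensor.mk (sp p) (Induced φ ρ) (Induced φ' ρ') v w ∈ G := fun r s h v hv w hw =>
      (le_iSup_of_le r (le_iSup_of_le s (le_iSup_of_le h le_rfl)) : _ ≤ G)
        (Submodule.apply_mem_map₂ _ hv hw)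
    suffices H : G ≤ G.comap (Algebra.lsmul ℂ ℂ (DiagTensor (sp p) (Induced φ ρ) (Induced φ' ρ'))
        (ιU (sp p) x)) from H ht
    conv_lhs => rw [hG]
    refine iSup_le fun r => iSup_le fun s => iSup_le fun h => Submodule.map₂_le.2 ?_
    intro v hv w hw
    change ιU (sp p) x • DiagTensor.mk (sp p) (Induced φ ρ) (Induced φ' ρ') v w ∈ G
    rw [DiagTensor.ι_smul_mk]
    exact add_mem (hle r s h _ (Φ.k_smul x hx r v hv) _ hw)
      (hle r s h _ hv _ (Ψ.k_smul x hx s w hw))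
  p_smul x hx n t ht := by
    set G := ⨆ (r : ℕ) (s : ℕ) (_ : r + s ≤ n + 1),
      Submodule.map₂ (DiagTensor.mk (sp p) (Induced φ ρ) (Induced φ' ρ')) (Φ.F r) (Ψ.F s) with hG
    have hle : ∀ r s, r + s ≤ n + 1 → ∀ v ∈ Φ.F r, ∀ w ∈ Ψ.F s,
        DiagTensor.mk (sp p) (Induced φ ρ) (Induced φ' ρ') v w ∈ G := fun r s h v hv w hw =>
      (le_iSup_of_le r (le_iSup_of_le s (le_iSup_of_le h le_rfl)) : _ ≤ G)
        (Submodule.apply_mem_map₂ _ hv hw)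
    refine (iSup_le fun r => iSup_le fun s => iSup_le fun h => Submodule.map₂_le.2 ?_ :
      _ ≤ G.comap (Algebra.lsmul ℂ ℂ (DiagTensor (sp p) (Induced φ ρ) (Induced φ' ρ'))
        (ιU (sp p) x))) ht
    intro v hv w hw
    change ιU (sp p) x • DiagTensor.mk (sp p) (Induced φ ρ) (Induced φ' ρ') v w ∈ G
    rw [DiagTensor.ι_smul_mk]
    exact add_mem (hle (r + 1) s (by omega) _ (Φ.p_smul x hx r v hv) _ hw)
      (hle r (s + 1) (by omega) _ hv _ (Ψ.p_smul x hx s w hw))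

end Filtration

/-! ### The modules `V`, `V_E`, `V_F` and the map `T` -/

section Main

variable (p : ℕ) (E F : Type*)
  [AddCommGroup E] [Module ℂ E] [LieRingModule (kLie p) E] [LieModule ℂ (kLie p) E]
  [AddCommGroup F] [Module ℂ F] [LieRingModule (kLie p) F] [LieModule ℂ (kLie p) F]

/-- The algebra homomorphism `U(𝔮⁺) → U(𝔤')`. -/
abbrev qPlusToG : U (qPlus p) →ₐ[ℂ] U (sp p) := envMap (qPlus p).incl

/-- The algebra homomorphism `U(𝔮⁻) → U(𝔤')`. -/
abbrev qMinusToG : U (qMinus p) →ₐ[ℂ] U (sp p) := envMap (qMinus p).incl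

/-- The action of `U(𝔮⁺)` on a `𝔨'`-module `E` for which `𝔭⁺` acts by zero. -/
abbrev plusAct : U (qPlus p) →ₐ[ℂ] Module.End ℂ E := (envAct (kLie p) E).comp (envMap (qPlusProj p))

/-- The action of `U(𝔮⁻)` on a `𝔨'`-module `F` for which `𝔭⁻` acts by zero. -/
abbrev minusAct : U (qMinus p) →ₐ[ℂ] Module.End ℂ F :=
  (envAct (kLie p) F).comp (envMap (qMinusProj p))

/-- `V_E = U(𝔤') ⊗_{U(𝔮⁺)} E`. -/
abbrev VPlus : Type _ := Induced (qPlusToG p) (plusAct p E)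

/-- `V_F = U(𝔤') ⊗_{U(𝔮⁻)} F`. -/
abbrev VMinus : Type _ := Induced (qMinusToG p) (minusAct p F)

/-- `V = U(𝔤') ⊗_{U(𝔨')} (E ⊗ F)`. -/
abbrev V : Type _ := Induced (kToG p) (envAct (kLie p) (E ⊗[ℂ] F))

/-- `V_E ⊗ V_F`, with the diagonal action of `𝔤'`. -/
abbrev VTensor : Type _ := DiagTensor (sp p) (VPlus p E) (VMinus p F)

theorem plus_k (x : kLie p) : ∃ a, qPlusToG p a = ιU (sp p) ((kLie p).incl x) ∧
    ∀ e, plusAct p E a e = ⁅x, e⁆ := by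
  have hx : x.1 ∈ (kLie p).toSubmodule ⊔ pPlus p := Submodule.mem_sup_left x.2
  have hp : qPlusProj p ⟨x.1, hx⟩ = x := kProj_k x
  refine ⟨ιU (qPlus p) ⟨x.1, hx⟩, envMap_ι _ _, fun e => ?_⟩
  rw [AlgHom.comp_apply, envMap_ι, envAct_ι, hp]

theorem minus_k (x : kLie p) : ∃ a, qMinusToG p a = ιU (sp p) ((kLie p).incl x) ∧
    ∀ f, minusAct p F a f = ⁅x, f⁆ := by
  have hx : x.1 ∈ (kLie p).toSubmodule ⊔ pMinus p := Submodule.mem_sup_left x.2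
  have hp : qMinusProj p ⟨x.1, hx⟩ = x := kProj_k x
  refine ⟨ιU (qMinus p) ⟨x.1, hx⟩, envMap_ι _ _, fun e => ?_⟩
  rw [AlgHom.comp_apply, envMap_ι, envAct_ι, hp]

/-- The `U(𝔤')`-linear map `T : V → V_E ⊗ V_F` with `T (1 ⊗ (e ⊗ f)) = (1 ⊗ e) ⊗ (1 ⊗ f)`, given by
Frobenius reciprocity. -/
def T : V p E F →ₗ[U (sp p)] VTensor p E F :=
  Induced.lift (tensorUnit (qPlusToG p) (plusAct p E) (qMinusToG p) (minusAct p F))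
    (tensorUnit_equivariant _ _ _ _ (kLie p).incl (plus_k p E) (minus_k p F))

theorem T_one (e : E) (f : F) :
    T p E F (Induced.mk (kToG p) (envAct (kLie p) (E ⊗[ℂ] F)) 1 (e ⊗ₜ f)) =
      DiagTensor.mk (sp p) (VPlus p E) (VMinus p F)
        (Induced.mk (qPlusToG p) (plusAct p E) 1 e)
        (Induced.mk (qMinusToG p) (minusAct p F) 1 f) := by
  exact one_smul (U (sp p)) _

/-- `V_n = (M n U(𝔨')) ⊗_{U(𝔨')} (E ⊗ F)`. -/
def filV : CartanFiltration p (V p E F) := inducedFil (kToG p) (envAct (kLie p) (E ⊗[ℂ] F))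

/-- `(V_E ⊗ V_F)_n = ∑_{r + s ≤ n} (M r U(𝔨') ⊗_{U(𝔮⁺)} E) ⊗ (M s U(𝔨') ⊗_{U(𝔮⁻)} F)`. -/
def filVTensor : CartanFiltration p (VTensor p E F) :=
  tensorFil (inducedFil (qPlusToG p) (plusAct p E)) (inducedFil (qMinusToG p) (minusAct p F))

end Main

end SpTensor

end

/-! Both sides have the size of S(𝔭⁻) ⊗ S(𝔭⁺) ⊗ E ⊗ F, and `T` is the identity on leading terms. In
V_E every vector is a combination of s ⊗ e with s ∈ S(𝔭⁻), because 𝔮⁺ never raises the degree in 𝔭⁻.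
Likewise V_F is spanned by the t ⊗ f with t ∈ S(𝔭⁺). Now apply s t to (1 ⊗ e) ⊗ (1 ⊗ f). Since 𝔭⁺
kills 1 ⊗ e, the factor t acts on the second tensor factor alone. By Leibniz, s then gives (s ⊗ e) ⊗
(t ⊗ f) plus terms in which some element of 𝔭⁻ hits V_F. As 𝔭⁻ ⊂ 𝔮⁻ does not raise degrees in V_F,
those terms have lower total degree (`T_mk_sub_mem`).

To exploit this, one needs the linear map b sending (s ⊗ e) ⊗ (t ⊗ f) to s t ⊗ (e ⊗ f), and b is
well defined only if the s ⊗ e and the t ⊗ f satisfy no unexpected relations. This is the one place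
where a Poincaré–Birkhoff–Witt statement enters. It is obtained directly: for L = 𝔮 ⊕ P with P
abelian and ad(P)³ = 0, an action of L on S(P) ⊗ E is constructed (`IsAbelianCompl.exists_action`,
`IsAbelianCompl.action_lie`), and Frobenius reciprocity yields a left inverse of S(P) ⊗ E → U(L) ⊗ E
over U(𝔮) (`IsAbelianCompl.exists_leftInverse`).

No independence is needed in V: b maps each filtration step onto the corresponding one, and T b - 1
lowers the degree. Induction on the degree then shows that `T` is bijective and that its inverse
preserves the filtrations, so the graded map is an isomorphism as well
(`IsApproxInverse.exists_equiv`). -/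

noncomputable section

namespace SpTensor

/-! ### Symmetric algebras and commuting families -/

section SymLift

variable {R M A : Type*} [CommRing R] [AddCommGroup M] [Module R M] [Ring A] [Algebra R A]

open scoped IsMulCommutative in
/-- The algebra homomorphism from the symmetric algebra attached to a linear map with commuting
values in an algebra that need not be commutative. -/
def symLift (f : M →ₗ[R] A) (hf : ∀ x y, f x * f y = f y * f x) : SymmetricAlgebra R M →ₐ[R] A :=
  have : IsMulCommutative (Algebra.adjoin R (Set.range f)) := Algebra.isMulCommutative_adjoin R (by
    rintro _ ⟨x, rfl⟩ _ ⟨y, rfl⟩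
    exact hf x y)
  (Algebra.adjoin R (Set.range f)).val.comp
    (SymmetricAlgebra.lift (f.codRestrict (Subalgebra.toSubmodule (Algebra.adjoin R (Set.range f)))
      fun x => Algebra.subset_adjoin ⟨x, rfl⟩))

open scoped IsMulCommutative in
theorem symLift_ι (f : M →ₗ[R] A) (hf : ∀ x y, f x * f y = f y * f x) (x : M) :
    symLift f hf (SymmetricAlgebra.ι R M x) = f x := by
  have : IsMulCommutative (Algebra.adjoin R (Set.range f)) := Algebra.isMulCommutative_adjoin R (by
    rintro _ ⟨x, rfl⟩ _ ⟨y, rfl⟩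
    exact hf x y)
  change ((SymmetricAlgebra.lift
    (f.codRestrict (Subalgebra.toSubmodule (Algebra.adjoin R (Set.range f)))
      fun x => Algebra.subset_adjoin ⟨x, rfl⟩) (SymmetricAlgebra.ι R M x) :
        Algebra.adjoin R (Set.range f)) : A) = f x
  rw [SymmetricAlgebra.lift_ι_apply]
  rfl

end SymLift

/-! ### Operators on `S(P) ⊗ E` with prescribed commutators -/

section Operators

variable {R P E : Type*} [CommRing R] [AddCommGroup P] [Module R P] [AddCommGroup E] [Module R E]

variable (R P E) in
/-- The free `S(P)`-module `S(P) ⊗ E`. -/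
abbrev SymTensor : Type _ := SymmetricAlgebra R P ⊗[R] E

local notation "sι" => SymmetricAlgebra.ι R P

/-- An operator on `S(P) ⊗ E` is determined by its commutators with `P` and its restriction to
`1 ⊗ E`. -/
theorem SymTensor.end_ext {Y Y' : Module.End R (SymTensor R P E)}
    (h : ∀ z m, Y (sι z • m) - sι z • Y m = Y' (sι z • m) - sι z • Y' m)
    (h1 : ∀ e, Y (1 ⊗ₜ e) = Y' (1 ⊗ₜ e)) : Y = Y' := by
  have key : ∀ (s : SymmetricAlgebra R P) (m : SymTensor R P E),
      Y m = Y' m → Y (s • m) = Y' (s • m) := by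
    intro s
    induction s using SymmetricAlgebra.induction with
    | algebraMap r => intro m hm; rw [algebraMap_smul, map_smul, map_smul, hm]
    | ι z =>
      intro m hm
      have := h z m
      rwa [hm, sub_left_inj] at this
    | mul a b ha hb => intro m hm; rw [mul_smul]; exact ha _ (hb _ hm)
    | add a b ha hb => intro m hm; rw [add_smul, map_add, map_add, ha _ hm, hb _ hm]
  apply TensorProduct.ext'
  intro s e
  have := key s (1 ⊗ₜ e) (h1 e)
  rwa [TensorProduct.smul_tmul', smul_eq_mul, mul_one] at this

/-- A family of endomorphisms satisfying the cocycle condition extends from `P` to `S(P)`: the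
algebra `S(P)` acts on `M × M` by operators that are triangular with `s` on the diagonal. -/
theorem exists_cocycle_extension {M : Type*} [AddCommGroup M] [Module R M]
    [Module (SymmetricAlgebra R P) M] [IsScalarTower R (SymmetricAlgebra R P) M]
    (A : P →ₗ[R] Module.End R M)
    (hA : ∀ z z' m, A z (sι z' • m) + sι z • A z' m = A z' (sι z • m) + sι z' • A z m) :
    ∃ F : SymmetricAlgebra R P →ₗ[R] M × M →ₗ[R] M, (∀ m, F 1 m = m.1) ∧
      ∀ z s m, F (sι z * s) m = sι z • F s m + A z (s • m.2) := by
  -- `B z` is the upper triangular block matrix with `z` twice on the diagonal and `A z` in the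
  -- corner.
  let B : P →ₗ[R] Module.End R (M × M) :=
    LinearMap.mk₂ R (fun z m => (sι z • m.1 + A z m.2, sι z • m.2))
      (fun z z' m => by
        ext1 <;> simp only [map_add, add_smul, LinearMap.add_apply, Prod.fst_add, Prod.snd_add]
        abel)
      (fun c z m => by
        ext1 <;> simp only [map_smul, smul_assoc, LinearMap.smul_apply, Prod.smul_fst,
          Prod.smul_snd, smul_add])
      (fun z m m' => by
        ext1 <;> simp only [map_add, smul_add, Prod.fst_add, Prod.snd_add]
        abel)
      (fun c z m => by
        ext1 <;> simp only [map_smul, smul_algebra_smul_comm c, Prod.smul_fst, Prod.smul_snd,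
          smul_add])
  -- The corner entries of the two products agree exactly by the cocycle condition `hA`.
  have hB : ∀ z z', B z * B z' = B z' * B z := by
    intro z z'
    apply LinearMap.ext
    intro m
    change (sι z • (sι z' • m.1 + A z' m.2) + A z (sι z' • m.2), sι z • sι z' • m.2) =
      (sι z' • (sι z • m.1 + A z m.2) + A z' (sι z • m.2), sι z' • sι z • m.2)
    ext1
    · simp only [smul_add, add_assoc]
      rw [smul_comm (sι z) (sι z'), add_comm (sι z • A z' m.2), add_comm (sι z' • A z m.2), hA]
    · exact smul_comm _ _ _
  have hsnd : ∀ s m, (symLift B hB s m).2 = s • m.2 := by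
    intro s
    induction s using SymmetricAlgebra.induction with
    | algebraMap r =>
      intro m; rw [AlgHom.commutes, Module.algebraMap_end_apply, algebraMap_smul]; rfl
    | ι z => intro m; rw [symLift_ι]; rfl
    | mul a b ha hb => intro m; rw [map_mul, Module.End.mul_apply, ha, hb, mul_smul]
    | add a b ha hb =>
      intro m
      rw [map_add, LinearMap.add_apply, Prod.snd_add, ha, hb, add_smul]
  let C : SymmetricAlgebra R P →ₗ[R] M × M →ₗ[R] M :=
    (symLift B hB).toLinearMap.compr₂ (LinearMap.fst R M M)
  have hC : ∀ s m, C s m = (symLift B hB s m).1 := fun _ _ => rfl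
  refine ⟨C, fun m => by rw [hC, map_one]; rfl, fun z s m => ?_⟩
  rw [hC, hC, map_mul, symLift_ι, Module.End.mul_apply, ← hsnd]
  rfl

/-- The condition `hA` expresses that the rule for moving `Y` past z and then z' is symmetric in
them. Let S(P) act on pairs by the triangular matrices above, starting from (f e, 1 ⊗ e): the second
entry of the result of s is s ⊗ e, and the first is taken as the value of `Y` there. -/
theorem SymTensor.exists_operator (A : P →ₗ[R] Module.End R (SymTensor R P E))
    (f : E →ₗ[R] SymTensor R P E)
    (hA : ∀ z z' m, A z (sι z' • m) + sι z • A z' m = A z' (sι z • m) + sι z' • A z m) :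
    ∃ Y : Module.End R (SymTensor R P E),
      (∀ z m, Y (sι z • m) = sι z • Y m + A z m) ∧ ∀ e, Y (1 ⊗ₜ e) = f e := by
  obtain ⟨F, hF1, hF⟩ := exists_cocycle_extension A hA
  let g : E →ₗ[R] SymTensor R P E × SymTensor R P E :=
    f.prod (TensorProduct.mk R (SymmetricAlgebra R P) E 1)
  have hg : ∀ e, g e = (f e, 1 ⊗ₜ e) := fun _ => rfl
  refine ⟨TensorProduct.lift (F.compl₂ g), fun z m => ?_, fun e => ?_⟩
  · induction m using TensorProduct.induction_on with
    | zero => simp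
    | add m m' h h' => simp only [smul_add, map_add, h, h']; abel
    | tmul s e =>
      rw [TensorProduct.smul_tmul', smul_eq_mul, TensorProduct.lift.tmul, TensorProduct.lift.tmul,
        LinearMap.compl₂_apply, LinearMap.compl₂_apply, hF, hg, TensorProduct.smul_tmul',
        smul_eq_mul, mul_one]
  · rw [TensorProduct.lift.tmul, LinearMap.compl₂_apply, hF1]; rfl

/-- The operators chosen one `x` at a time depend linearly on `x`, because `SymTensor.end_ext` makes
each of them unique. -/
theorem SymTensor.exists_operator_family {L : Type*} [AddCommGroup L] [Module R L]
    (A : L →ₗ[R] P →ₗ[R] Module.End R (SymTensor R P E)) (f : L →ₗ[R] E →ₗ[R] SymTensor R P E)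
    (hA : ∀ x z z' m, A x z (sι z' • m) + sι z • A x z' m = A x z' (sι z • m) + sι z' • A x z m) :
    ∃ D : L →ₗ[R] Module.End R (SymTensor R P E),
      (∀ x z m, D x (sι z • m) = sι z • D x m + A x z m) ∧ ∀ x e, D x (1 ⊗ₜ e) = f x e := by
  choose D hD hD1 using fun x => SymTensor.exists_operator (A x) (f x) (hA x)
  refine ⟨{ toFun := D, map_add' := fun x y => ?_, map_smul' := fun c x => ?_ }, hD, hD1⟩
  · refine SymTensor.end_ext (fun z m => ?_) fun e => ?_
    · simp only [hD, LinearMap.add_apply, map_add, smul_add]; abel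
    · simp only [hD1, LinearMap.add_apply, map_add]
  · refine SymTensor.end_ext (fun z m => ?_) fun e => ?_
    · simp only [hD, LinearMap.smul_apply, map_smul, smul_add, RingHom.id_apply, smul_comm _ c]; abel
    · simp only [hD1, LinearMap.smul_apply, map_smul, RingHom.id_apply]

end Operators

/-! ### The action of a Lie algebra `L = 𝔮 ⊕ P` on `S(P) ⊗ E` -/

section Model

variable {R L : Type*} [CommRing R] [LieRing L] [LieAlgebra R L]

/-- The subspace `P` is an abelian complement of the subalgebra `𝔮`, and `ad(P)³ = 0`. -/
structure IsAbelianCompl (q : LieSubalgebra R L) (P : Submodule R L) : Prop where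
  isCompl : IsCompl q.toSubmodule P
  lie_eq_zero : ∀ z ∈ P, ∀ z' ∈ P, ⁅z, z'⁆ = (0 : L)
  lie_lie_lie_eq_zero : ∀ x : L, ∀ z ∈ P, ∀ z' ∈ P, ∀ z'' ∈ P, ⁅⁅⁅x, z⁆, z'⁆, z''⁆ = 0

/-- The elements killed by `ad(P)ⁿ`. -/
def adKer (P : Submodule R L) : ℕ → Submodule R L
  | 0 => ⊥
  | n + 1 =>
    { carrier := {x | ∀ z ∈ P, ⁅x, z⁆ ∈ adKer P n}
      zero_mem' := fun z _ => by rw [zero_lie]; exact zero_mem _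
      add_mem' := fun hx hy z hz => by rw [add_lie]; exact add_mem (hx z hz) (hy z hz)
      smul_mem' := fun c x hx z hz => by rw [smul_lie]; exact Submodule.smul_mem _ c (hx z hz) }

variable {q : LieSubalgebra R L} {P : Submodule R L}

theorem IsAbelianCompl.le_adKer (h : IsAbelianCompl q P) (n : ℕ) : P ≤ adKer P (n + 1) :=
  fun x hx z hz => by rw [h.lie_eq_zero x hx z hz]; exact zero_mem _

theorem IsAbelianCompl.mem_adKer (h : IsAbelianCompl q P) (x : L) : x ∈ adKer P 3 :=
  fun z hz z' hz' z'' hz'' => (Submodule.mem_bot R).2 (h.lie_lie_lie_eq_zero x z hz z' hz' z'' hz'')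

theorem IsAbelianCompl.exists_decomp (h : IsAbelianCompl q P) (x : L) :
    ∃ y : q, ∃ z ∈ P, x = y + z := by
  have hx : x ∈ q.toSubmodule ⊔ P := h.isCompl.sup_eq_top ▸ Submodule.mem_top
  obtain ⟨y, hy, z, hz, rfl⟩ := Submodule.mem_sup.1 hx
  exact ⟨⟨y, hy⟩, z, hz, rfl⟩

variable {E : Type*} [AddCommGroup E] [Module R E]

local notation "sι" => SymmetricAlgebra.ι R P

/-- The action on `1 ⊗ E` of `L = 𝔮 ⊕ P` on the `L`-module `S(P) ⊗ E` induced from `𝔮`. -/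
def IsAbelianCompl.unitAct (h : IsAbelianCompl q P) (ρ : q →ₗ[R] Module.End R E) :
    L →ₗ[R] E →ₗ[R] SymTensor R P E :=
  LinearMap.mk₂ R (fun x e => 1 ⊗ₜ ρ (q.toSubmodule.projectionOnto P h.isCompl x) e +
      sι (P.projectionOnto q.toSubmodule h.isCompl.symm x) ⊗ₜ e)
    (fun x y e => by simp only [map_add, LinearMap.add_apply, TensorProduct.tmul_add,
      TensorProduct.add_tmul]; abel)
    (fun c x e => by simp only [map_smul, LinearMap.smul_apply, TensorProduct.tmul_smul,
      TensorProduct.smul_tmul', smul_add])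
    (fun x e e' => by simp only [map_add, TensorProduct.tmul_add]; abel)
    (fun c x e => by simp only [map_smul, TensorProduct.tmul_smul, smul_add])

theorem IsAbelianCompl.unitAct_left (h : IsAbelianCompl q P) (ρ : q →ₗ[R] Module.End R E) (x : q)
    (e : E) : h.unitAct ρ x e = 1 ⊗ₜ ρ x e := by
  change 1 ⊗ₜ ρ (q.toSubmodule.projectionOnto P h.isCompl x) e +
      sι (P.projectionOnto q.toSubmodule h.isCompl.symm x) ⊗ₜ e = _
  have h1 : q.toSubmodule.projectionOnto P h.isCompl (x : L) = x :=
    Submodule.projectionOnto_apply_left h.isCompl x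
  have h2 : P.projectionOnto q.toSubmodule h.isCompl.symm (x : L) = 0 :=
    Submodule.projectionOnto_apply_right h.isCompl.symm x
  rw [h1, h2, map_zero, TensorProduct.zero_tmul, add_zero]

theorem IsAbelianCompl.unitAct_right (h : IsAbelianCompl q P) (ρ : q →ₗ[R] Module.End R E) (z : P)
    (e : E) : h.unitAct ρ z e = sι z ⊗ₜ e := by
  change 1 ⊗ₜ ρ (q.toSubmodule.projectionOnto P h.isCompl z) e +
      sι (P.projectionOnto q.toSubmodule h.isCompl.symm z) ⊗ₜ e = _
  have h1 : P.projectionOnto q.toSubmodule h.isCompl.symm (z : L) = z :=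
    Submodule.projectionOnto_apply_left h.isCompl.symm z
  have h2 : q.toSubmodule.projectionOnto P h.isCompl (z : L) = 0 :=
    Submodule.projectionOnto_apply_right h.isCompl z
  rw [h1, h2, map_zero, LinearMap.zero_apply, TensorProduct.tmul_zero, zero_add]

/-- The commutation rule refers to `D` itself, but at ⁅x, z⁆, which is closer to being killed by
ad(P). So iterate: start from operators commuting with P and correct twice. Since ad(P)³ = 0, the
third approximation `D₃` already satisfies the rule exactly. -/
theorem IsAbelianCompl.exists_action (h : IsAbelianCompl q P) (f : L →ₗ[R] E →ₗ[R] SymTensor R P E) :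
    ∃ D : L →ₗ[R] Module.End R (SymTensor R P E),
      (∀ x (z : P) m, D x (sι z • m) = sι z • D x m + D ⁅x, (z : L)⁆ m) ∧
        ∀ x e, D x (1 ⊗ₜ e) = f x e := by
  let ad (D : L →ₗ[R] Module.End R (SymTensor R P E)) :
      L →ₗ[R] P →ₗ[R] Module.End R (SymTensor R P E) :=
    LinearMap.mk₂ R (fun x z => D ⁅x, (z : L)⁆) (by simp) (by simp) (by simp) (by simp)
  have had : ∀ D x z, ad D x z = D ⁅x, (z : L)⁆ := fun _ _ _ => rfl
  obtain ⟨D₁, h₁, h₁'⟩ := SymTensor.exists_operator_family (P := P) (0 : L →ₗ[R] _) f (by simp)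
  obtain ⟨D₂, h₂, h₂'⟩ := SymTensor.exists_operator_family (P := P) (ad D₁) f (by
    intro x z z' m
    simp only [had, h₁, LinearMap.zero_apply, add_zero]
    exact add_comm _ _)
  obtain ⟨D₃, h₃, h₃'⟩ := SymTensor.exists_operator_family (P := P) (ad D₂) f (by
    intro x z z' m
    -- Jacobi together with ⁅z, z'⁆ = 0; this symmetry is the cocycle condition.
    have e : ⁅⁅x, (z : L)⁆, (z' : L)⁆ = ⁅⁅x, (z' : L)⁆, (z : L)⁆ := by
      rw [lie_lie x (z : L) (z' : L), h.lie_eq_zero z z.2 z' z'.2, lie_zero, zero_sub, ← lie_skew,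
        neg_neg]
    simp only [had, h₂, e]
    abel)
  -- The iteration stabilises: one step suffices on what ad(P) kills, two on what ad(P)² kills, and
  -- ⁅x, z⁆ is of the latter kind.
  have e₁ : ∀ v, (∀ z ∈ P, ⁅v, z⁆ = 0) → D₁ v = D₂ v := fun v hv =>
    SymTensor.end_ext (fun z m => by simp [h₁, h₂, had, hv z z.2]) fun e => by rw [h₁', h₂']
  have e₂ : ∀ u, (∀ z ∈ P, ∀ z' ∈ P, ⁅⁅u, z⁆, z'⁆ = 0) → D₂ u = D₃ u := fun u hu =>
    SymTensor.end_ext (fun z m => by simp [h₂, h₃, had, e₁ _ (hu z z.2)]) fun e => by rw [h₂', h₃']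
  refine ⟨D₃, fun x z m => ?_, h₃'⟩
  rw [h₃, had, e₂ _ (h.lie_lie_lie_eq_zero x z z.2)]

/-- As P is abelian, both operators commute with multiplication by P, and they agree on 1 ⊗ E. -/
theorem IsAbelianCompl.action_right (h : IsAbelianCompl q P) {ρ : q →ₗ[R] Module.End R E}
    {D : L →ₗ[R] Module.End R (SymTensor R P E)}
    (hD : ∀ x (z : P) m, D x (sι z • m) = sι z • D x m + D ⁅x, (z : L)⁆ m)
    (hD1 : ∀ x e, D x (1 ⊗ₜ e) = h.unitAct ρ x e) (z : P) (m : SymTensor R P E) :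
    D z m = sι z • m := by
  suffices H : D z = Algebra.lsmul R R (SymTensor R P E) (sι z) by rw [H]; rfl
  refine SymTensor.end_ext (fun z' m => ?_) fun e => ?_
  · rw [hD, h.lie_eq_zero z z.2 z' z'.2]
    simp [smul_comm (sι z) (sι z')]
  · rw [hD1, h.unitAct_right]
    simp [TensorProduct.smul_tmul']

/-- When one argument lies in P the identity is the commutation rule. For x and y in 𝔮, compare both
sides by `SymTensor.end_ext`: on 1 ⊗ E they agree because `ρ` is a representation, and by Jacobi
their commutators with z involve only the pairs (⁅x, z⁆, y) and (x, ⁅y, z⁆). These are nearer to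
being killed by ad(P), so induction on the sum of the two nilpotency orders applies. -/
theorem IsAbelianCompl.action_lie (h : IsAbelianCompl q P) {ρ : q →ₗ[R] Module.End R E}
    (hρ : ∀ x y e, ρ ⁅x, y⁆ e = ρ x (ρ y e) - ρ y (ρ x e))
    {D : L →ₗ[R] Module.End R (SymTensor R P E)}
    (hD : ∀ x (z : P) m, D x (sι z • m) = sι z • D x m + D ⁅x, (z : L)⁆ m)
    (hD1 : ∀ x e, D x (1 ⊗ₜ e) = h.unitAct ρ x e) (x y : L) (m : SymTensor R P E) :
    D ⁅x, y⁆ m = D x (D y m) - D y (D x m) := by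
  have hr : ∀ x, ∀ z ∈ P, ∀ m, D ⁅x, z⁆ m = D x (D z m) - D z (D x m) := by
    intro x z hz m
    have e := hD x ⟨z, hz⟩ m
    rw [h.action_right hD hD1 ⟨z, hz⟩, h.action_right hD hD1 ⟨z, hz⟩, e]
    abel
  have hl : ∀ z ∈ P, ∀ y m, D ⁅z, y⁆ m = D z (D y m) - D y (D z m) := by
    intro z hz y m
    rw [← lie_skew, map_neg, LinearMap.neg_apply, hr y z hz, neg_sub]
  have key : ∀ n i j, i + j ≤ n → ∀ x ∈ adKer P i, ∀ y ∈ adKer P j, ∀ m,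
      D ⁅x, y⁆ m = D x (D y m) - D y (D x m) := by
    intro n
    induction n with
    | zero =>
      intro i j hij x hx y _ m
      obtain rfl : i = 0 := by omega
      rw [(Submodule.mem_bot R).1 hx]; simp
    | succ n ih =>
      intro i j hij x hx y hy
      obtain _ | i := i
      · rw [(Submodule.mem_bot R).1 hx]; simp
      obtain _ | j := j
      · rw [(Submodule.mem_bot R).1 hy]; simp
      obtain ⟨x, a, ha, rfl⟩ := h.exists_decomp x
      obtain ⟨y, b, hb, rfl⟩ := h.exists_decomp y
      -- Removing the P-component keeps the nilpotency order, since ad(P) kills P at once.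
      have hx' : (x : L) ∈ adKer P (i + 1) := by simpa using sub_mem hx (h.le_adKer i ha)
      have hy' : (y : L) ∈ adKer P (j + 1) := by simpa using sub_mem hy (h.le_adKer j hb)
      have hxy : D ⁅(x : L), (y : L)⁆ = D x ∘ₗ D y - D y ∘ₗ D x := by
        refine SymTensor.end_ext (fun z m => ?_) fun e => ?_
        · have i1 := ih i (j + 1) (by omega) _ (hx' z z.2) _ hy' m
          have i2 := ih (i + 1) j (by omega) _ hx' _ (hy' z z.2) m
          have i3 : ⁅⁅(x : L), (y : L)⁆, (z : L)⁆ = ⁅⁅(x : L), (z : L)⁆, (y : L)⁆ +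
              ⁅(x : L), ⁅(y : L), (z : L)⁆⁆ := by
            rw [lie_lie (x : L) (y : L) (z : L), ← lie_skew ⁅(x : L), (z : L)⁆ (y : L)]; abel
          simp only [LinearMap.sub_apply, LinearMap.comp_apply, hD, map_add, i3,
            LinearMap.add_apply, i1, i2, smul_sub]
          abel
        · have i1 : ⁅(x : L), (y : L)⁆ = ((⁅x, y⁆ : q) : L) := rfl
          simp only [LinearMap.sub_apply, LinearMap.comp_apply, i1, hD1, h.unitAct_left, hρ,
            TensorProduct.tmul_sub]
      intro m
      have e := LinearMap.congr_fun hxy m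
      rw [LinearMap.sub_apply, LinearMap.comp_apply, LinearMap.comp_apply] at e
      rw [add_lie, map_add, LinearMap.add_apply, hl a ha, lie_add, map_add, LinearMap.add_apply, e,
        hr _ b hb]
      simp only [map_add, LinearMap.add_apply]
      abel
  -- By ad(P)³ = 0 every element has order at most 3, whence 6 = 3 + 3.
  exact key 6 3 3 le_rfl x (h.mem_adKer x) y (h.mem_adKer y) m

end Model

/-! ### Modules induced from a subalgebra with an abelian complement -/

section InducedModel

section

attribute [local instance] LieRing.ofAssociativeRing

/-- Frobenius reciprocity for a target given as a Lie algebra representation. -/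
theorem Induced.exists_lift {L M N : Type*} [LieRing L] [LieAlgebra ℂ L] [AddCommGroup M] [Module ℂ M] [AddCommGroup N] [Module ℂ N] {K : Type*} [LieRing K]
    [LieAlgebra ℂ K] (φ : K →ₗ⁅ℂ⁆ L) (ρ : U K →ₐ[ℂ] Module.End ℂ M) (D : L →ₗ[ℂ] Module.End ℂ N)
    (hD : ∀ x y n, D ⁅x, y⁆ n = D x (D y n) - D y (D x n)) (f : M →ₗ[ℂ] N)
    (hf : ∀ x m, f (ρ (ιU K x) m) = D (φ x) (f m)) :
    ∃ c : Induced (envMap φ) ρ →ₗ[ℂ] N, (∀ m, c (Induced.mk (envMap φ) ρ 1 m) = f m) ∧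
      ∀ x v, c (ιU L x • v) = D x (c v) := by
  let g : L →ₗ⁅ℂ⁆ Module.End ℂ N :=
    { D with map_lie' := by intro x y; ext n; exact hD x y n }
  let Φ : U L →ₐ[ℂ] Module.End ℂ N := UniversalEnvelopingAlgebra.lift ℂ g
  have hΦ : ∀ x, Φ (ιU L x) = D x := fun x => UniversalEnvelopingAlgebra.lift_ι_apply ℂ g x
  let _ : Module (U L) N := Module.compHom N Φ.toRingHom
  have hs : ∀ (u : U L) (n : N), u • n = Φ u n := fun _ _ => rfl
  have : IsScalarTower ℂ (U L) N := ⟨fun c u n => by rw [hs, hs, map_smul]; rfl⟩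
  let c := Induced.lift (φ := envMap φ) (ρ := ρ) f
    (env_equivariant (envMap φ) ρ f fun x m => by rw [envMap_ι, hs, hΦ, hf])
  refine ⟨c.restrictScalars ℂ, fun m => ?_, fun x v => ?_⟩
  · exact one_smul (U L) (f m)
  · exact (c.map_smul (ιU L x) v).trans (by rw [hs, hΦ]; rfl)

end

variable {L : Type*} [LieRing L] [LieAlgebra ℂ L] {q : LieSubalgebra ℂ L} {P : Submodule ℂ L}
  {E : Type*} [AddCommGroup E] [Module ℂ E]

/-- The homomorphism `S(P) → U(L)` for an abelian subspace `P`. -/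
def IsAbelianCompl.symU (h : IsAbelianCompl q P) : SymmetricAlgebra ℂ P →ₐ[ℂ] U L :=
  symLift ((ιU L).comp P.subtype) fun x y => by
    have := ιU_lie (x : L) y
    rw [h.lie_eq_zero x x.2 y y.2, map_zero] at this
    exact (sub_eq_zero.1 this.symm)

theorem IsAbelianCompl.symU_ι (h : IsAbelianCompl q P) (z : P) :
    h.symU (SymmetricAlgebra.ι ℂ P z) = ιU L z := symLift_ι _ _ z

/-- Lets products of j elements of P in U(L) be lifted to homogeneous elements of S(P), on which the
left inverse below is computed. -/
theorem IsAbelianCompl.map_symU (h : IsAbelianCompl q P) (j : ℕ) :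
    ((SymmetricAlgebra.ι ℂ P).range ^ j).map h.symU.toLinearMap = P.map (ιU L) ^ j := by
  rw [Submodule.map_pow]
  congr 1
  ext u
  constructor
  · rintro ⟨_, ⟨z, rfl⟩, rfl⟩
    exact ⟨z, z.2, (h.symU_ι z).symm⟩
  · rintro ⟨z, hz, rfl⟩
    exact ⟨_, ⟨⟨z, hz⟩, rfl⟩, h.symU_ι ⟨z, hz⟩⟩

/-- The map `S(P) ⊗ E → U(L) ⊗_{U(𝔮)} E` has a left inverse. -/
theorem IsAbelianCompl.exists_leftInverse (h : IsAbelianCompl q P) (ρ : U q →ₐ[ℂ] Module.End ℂ E) :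
    ∃ c : Induced (envMap q.incl) ρ →ₗ[ℂ] SymTensor ℂ P E,
      ∀ s e, c (Induced.mk (envMap q.incl) ρ (h.symU s) e) = s ⊗ₜ e := by
  let ρ' : q →ₗ[ℂ] Module.End ℂ E := ρ.toLinearMap ∘ₗ ιU q
  have hρ : ∀ x y e, ρ' ⁅x, y⁆ e = ρ' x (ρ' y e) - ρ' y (ρ' x e) := by
    intro x y e
    change ρ (ιU q ⁅x, y⁆) e = _
    rw [ιU_lie, map_sub, map_mul, map_mul]
    rfl
  obtain ⟨D, hD, hD1⟩ := h.exists_action (h.unitAct ρ')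
  obtain ⟨c, hc1, hc⟩ := Induced.exists_lift q.incl ρ D (h.action_lie hρ hD hD1)
    (TensorProduct.mk ℂ (SymmetricAlgebra ℂ P) E 1) (fun x e => by
      change 1 ⊗ₜ ρ' x e = D (x : L) (1 ⊗ₜ e)
      rw [hD1, h.unitAct_left])
  -- P acts on the model by multiplication, so `c` is S(P)-linear and recovers s ⊗ e from s • (1 ⊗
  -- e).
  have key : ∀ s v, c (h.symU s • v) = s • c v := by
    intro s
    induction s using SymmetricAlgebra.induction with
    | algebraMap r =>
      intro v; rw [AlgHom.commutes, algebraMap_smul, algebraMap_smul, map_smul]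
    | ι z => intro v; rw [h.symU_ι, hc, h.action_right hD hD1]
    | mul a b ha hb => intro v; rw [map_mul, mul_smul, mul_smul, ha, hb]
    | add a b ha hb => intro v; rw [map_add, add_smul, add_smul, map_add, ha, hb]
  refine ⟨c, fun s e => ?_⟩
  have := key s (Induced.mk (envMap q.incl) ρ 1 e)
  rw [hc1, Induced.smul_mk, mul_one] at this
  rw [this, TensorProduct.mk_apply, TensorProduct.smul_tmul', smul_eq_mul, mul_one]

/-! ### Degree in the abelian complement. -/

/-- The subspace of `U(L) ⊗_A E` of elements of degree at most `n` in `P`. -/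
def degLE {A : Type*} [Ring A] [Algebra ℂ A] (φ : A →ₐ[ℂ] U L) (ρ : A →ₐ[ℂ] Module.End ℂ E)
    (P : Submodule ℂ L) (n : ℕ) : Submodule ℂ (Induced φ ρ) :=
  ⨆ (j : ℕ) (_ : j ≤ n), Submodule.map₂ (Induced.mk φ ρ) (P.map (ιU L) ^ j) ⊤

section degLE

variable {A : Type*} [Ring A] [Algebra ℂ A] (φ : A →ₐ[ℂ] U L) (ρ : A →ₐ[ℂ] Module.End ℂ E)

theorem mk_mem_degLE {j n : ℕ} (hj : j ≤ n) {u : U L} (hu : u ∈ P.map (ιU L) ^ j) (e : E) :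
    Induced.mk φ ρ u e ∈ degLE φ ρ P n :=
  Submodule.mem_iSup_of_mem j (Submodule.mem_iSup_of_mem hj
    (Submodule.apply_mem_map₂ _ hu Submodule.mem_top))

theorem degLE_le {n : ℕ} {S : Submodule ℂ (Induced φ ρ)}
    (h : ∀ j ≤ n, ∀ u ∈ P.map (ιU L) ^ j, ∀ e, Induced.mk φ ρ u e ∈ S) : degLE φ ρ P n ≤ S :=
  iSup_le fun j => iSup_le fun hj => Submodule.map₂_le.2 fun u hu e _ => h j hj u hu e

theorem degLE_mono {m n : ℕ} (h : m ≤ n) : degLE φ ρ P m ≤ degLE φ ρ P n :=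
  degLE_le φ ρ fun _ hj _ hu e => mk_mem_degLE φ ρ (hj.trans h) hu e

theorem smul_mem_degLE_succ {z : L} (hz : z ∈ P) {n : ℕ} {v : Induced φ ρ}
    (hv : v ∈ degLE φ ρ P n) : ιU L z • v ∈ degLE φ ρ P (n + 1) := by
  refine (degLE_le φ ρ (S := (degLE φ ρ P (n + 1)).comap
      (Algebra.lsmul ℂ ℂ (Induced φ ρ) (ιU L z)))
    fun j hj u hu e => ?_) hv
  change ιU L z • Induced.mk φ ρ u e ∈ degLE φ ρ P (n + 1)
  rw [Induced.smul_mk]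
  refine mk_mem_degLE φ ρ (Nat.succ_le_succ hj) ?_ e
  rw [pow_succ']
  exact Submodule.mul_mem_mul ⟨z, hz, rfl⟩ hu

end degLE

/-- Move x ∈ 𝔮 to the right through the factors from P until it is absorbed by E. Each exchange
replaces a factor z by ⁅x, z⁆, whose P-component keeps the degree and whose 𝔮-component faces a
shorter product. -/
theorem IsAbelianCompl.smul_mem_degLE (h : IsAbelianCompl q P) (ρ : U q →ₐ[ℂ] Module.End ℂ E)
    (x : q) {n : ℕ} {v : Induced (envMap q.incl) ρ} (hv : v ∈ degLE (envMap q.incl) ρ P n) :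
    ιU L x • v ∈ degLE (envMap q.incl) ρ P n := by
  have key : ∀ (j : ℕ), ∀ u ∈ P.map (ιU L) ^ j, ∀ (x : q) (e : E),
      ιU L x • Induced.mk (envMap q.incl) ρ u e ∈ degLE (envMap q.incl) ρ P j := by
    intro j
    induction j with
    | zero =>
      intro u hu x e
      rw [pow_zero] at hu
      obtain ⟨r, rfl⟩ := Submodule.mem_one.1 hu
      have e1 : ιU L x • Induced.mk (envMap q.incl) ρ (algebraMap ℂ (U L) r) e =
          Induced.mk (envMap q.incl) ρ (algebraMap ℂ (U L) r) (ρ (ιU q x) e) := by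
        rw [← Induced.mk_mul, Induced.smul_mk, envMap_ι, Algebra.commutes]
        rfl
      rw [e1]
      exact mk_mem_degLE _ ρ le_rfl (by rw [pow_zero]; exact hu) _
    | succ j ih =>
      intro u hu x e
      rw [pow_succ'] at hu
      induction hu using Submodule.mul_induction_on' with
      | add a _ b _ ha hb =>
        rw [map_add, LinearMap.add_apply, smul_add]
        exact add_mem ha hb
      | mem_mul_mem a ha u hu =>
        obtain ⟨z, hz, rfl⟩ := ha
        obtain ⟨y, w, hw, hyw⟩ := h.exists_decomp ⁅(x : L), z⁆
        have e1 : ιU L x • Induced.mk (envMap q.incl) ρ (ιU L z * u) e =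
            ιU L z • ιU L x • Induced.mk (envMap q.incl) ρ u e +
              (ιU L y • Induced.mk (envMap q.incl) ρ u e +
                ιU L w • Induced.mk (envMap q.incl) ρ u e) := by
          rw [← add_smul, ← map_add, ← hyw, ιU_lie, ← Induced.smul_mk, sub_smul, mul_smul, mul_smul]
          abel
        rw [e1]
        exact add_mem (smul_mem_degLE_succ _ ρ hz (ih u hu x e)) (add_mem
          (degLE_mono _ ρ j.le_succ (ih u hu y e))
          (smul_mem_degLE_succ _ ρ hw (mk_mem_degLE _ ρ le_rfl hu e)))
  refine (degLE_le _ ρ (S := (degLE (envMap q.incl) ρ P n).comap (Algebra.lsmul ℂ ℂ _ (ιU L x)))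
    fun j hj u hu e => degLE_mono _ ρ hj (key j u hu x e)) hv

end InducedModel

/-! ### Filtered isomorphisms -/

namespace CartanFiltration

variable {p : ℕ} {W W' : Type*} [AddCommGroup W] [Module ℂ W] [Module (U (sp p)) W]
  [IsScalarTower ℂ (U (sp p)) W] [AddCommGroup W'] [Module ℂ W'] [Module (U (sp p)) W']
  [IsScalarTower ℂ (U (sp p)) W'] {Φ : CartanFiltration p W} {Ψ : CartanFiltration p W'}

/-- `b` is a right inverse of `T` up to terms of lower degree. -/
structure IsApproxInverse (Φ : CartanFiltration p W) (Ψ : CartanFiltration p W')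
    (T : W →ₗ[U (sp p)] W') (b : W' →ₗ[ℂ] W) : Prop where
  map_eq : ∀ n, (Ψ.F n).map b = Φ.F n
  sub_mem : ∀ n, ∀ w ∈ Ψ.F n, T (b w) - w ∈ Ψ.prev n
  exhaustive : ∀ v, ∃ n, v ∈ Φ.F n
  exhaustive' : ∀ w, ∃ n, w ∈ Ψ.F n

variable {T : W →ₗ[U (sp p)] W'} {b : W' →ₗ[ℂ] W}

namespace IsApproxInverse

theorem preserves (h : IsApproxInverse Φ Ψ T b) : Preserves Φ Ψ T := by
  intro n v hv
  rw [← h.map_eq] at hv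
  obtain ⟨w, hw, rfl⟩ := hv
  simpa using add_mem (Ψ.prev_le n (h.sub_mem n w hw)) hw

/-- Strictness of `T`. Write v = b w with w of degree m. If m > n, then T (b w) has degree below m
and so has its difference from w, hence w has degree at most m - 1; descend until n is reached. -/
theorem mem_of_apply_mem (h : IsApproxInverse Φ Ψ T b) {n : ℕ} {v : W} (hv : T v ∈ Ψ.F n) :
    v ∈ Φ.F n := by
  have key : ∀ m, ∀ w ∈ Ψ.F m, T (b w) ∈ Ψ.F n → w ∈ Ψ.F n := by
    intro m
    induction m with
    | zero => exact fun w hw _ => monotone_nat_of_le_succ Ψ.mono n.zero_le hw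
    | succ m ih =>
      intro w hw hTw
      by_cases hnm : m + 1 ≤ n
      · exact monotone_nat_of_le_succ Ψ.mono hnm hw
      · refine ih w ?_ hTw
        simpa using _root_.sub_mem (monotone_nat_of_le_succ Ψ.mono (by omega : n ≤ m) hTw)
          (h.sub_mem _ w hw)
  obtain ⟨m, hm⟩ := h.exhaustive v
  rw [← h.map_eq] at hm
  obtain ⟨w, hw, rfl⟩ := hm
  rw [← h.map_eq]
  exact ⟨w, key m w hw hv, rfl⟩

/-- If T (b w) = 0, then w equals its own error term, so its degree drops repeatedly and w ends in
`prev 0 = ⊥`. Since `b` maps onto each filtration step, no injectivity of `b` is required. -/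
theorem injective (h : IsApproxInverse Φ Ψ T b) : Function.Injective T := by
  rw [injective_iff_map_eq_zero]
  have key : ∀ m, ∀ w ∈ Ψ.F m, T (b w) = 0 → w = 0 := by
    intro m
    induction m with
    | zero =>
      intro w hw hTw
      have := h.sub_mem 0 w hw
      rw [hTw, zero_sub] at this
      exact neg_eq_zero.1 ((Submodule.mem_bot ℂ).1 this)
    | succ m ih =>
      intro w hw hTw
      have := h.sub_mem _ w hw
      rw [hTw, zero_sub] at this
      exact ih w (neg_mem_iff.1 this) hTw
  intro v hv
  obtain ⟨m, hm⟩ := h.exhaustive v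
  rw [← h.map_eq] at hm
  obtain ⟨w, hw, rfl⟩ := hm
  rw [key m w hw hv, map_zero]

/-- Approximate a preimage of w by b w; the error has lower degree and is in the image by induction.
-/
theorem surjective (h : IsApproxInverse Φ Ψ T b) : Function.Surjective T := by
  have key : ∀ n, ∀ w ∈ Ψ.F n, ∃ v, T v = w := by
    intro n
    induction n with
    | zero =>
      exact fun w hw => ⟨b w, sub_eq_zero.1 ((Submodule.mem_bot ℂ).1 (h.sub_mem 0 w hw))⟩
    | succ n ih =>
      intro w hw
      obtain ⟨v, hv⟩ := ih _ (h.sub_mem _ w hw)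
      exact ⟨b w - v, by rw [map_sub, hv, sub_sub_cancel]⟩
  intro w
  obtain ⟨n, hn⟩ := h.exhaustive' w
  exact key n w hn

end IsApproxInverse

end CartanFiltration

section grEquiv

open CartanFiltration

variable {p : ℕ} {W W' : Type*} [AddCommGroup W] [Module ℂ W] [Module (U (sp p)) W]
  [IsScalarTower ℂ (U (sp p)) W] [AddCommGroup W'] [Module ℂ W'] [Module (U (sp p)) W']
  [IsScalarTower ℂ (U (sp p)) W'] {Φ : CartanFiltration p W} {Ψ : CartanFiltration p W'}

/-- Functoriality of the associated graded space, needed only for mutually inverse maps. -/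
theorem CartanFiltration.Preserves.grMapAux_grMapAux {T : W →ₗ[U (sp p)] W'}
    {T' : W' →ₗ[U (sp p)] W} (hT : Preserves Φ Ψ T) (hT' : Preserves Ψ Φ T')
    (h : ∀ v, T' (T v) = v) (v : Φ.Gr) : hT'.grMapAux (hT.grMapAux v) = v := by
  suffices H : hT'.grMapAux ∘ₗ hT.grMapAux = LinearMap.id from LinearMap.congr_fun H v
  apply Gr.hom_ext
  intro n w
  rw [LinearMap.comp_apply, Preserves.grMapAux_incl, Preserves.grMapAux_incl, LinearMap.id_apply]
  congr 2
  exact Subtype.ext (h w)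

theorem CartanFiltration.Preserves.grMap_bijective {e : W ≃ₗ[U (sp p)] W'}
    (hT : Preserves Φ Ψ e.toLinearMap) (hT' : Preserves Ψ Φ e.symm.toLinearMap) :
    Function.Bijective hT.grMap :=
  Function.bijective_iff_has_inverse.2 ⟨hT'.grMapAux,
    hT.grMapAux_grMapAux hT' fun v => e.symm_apply_apply v,
    hT'.grMapAux_grMapAux hT fun v => e.apply_symm_apply v⟩

/-- A map of filtered modules with an approximate inverse is an isomorphism, and so is the induced
map of associated graded modules. -/
theorem CartanFiltration.IsApproxInverse.exists_equiv {T : W →ₗ[U (sp p)] W'} {b : W' →ₗ[ℂ] W}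
    (h : IsApproxInverse Φ Ψ T b) :
    (∃ e : W ≃ₗ[U (sp p)] W', ∀ v, e v = T v) ∧
      ∃ hT : Preserves Φ Ψ T, ∃ e : Φ.Gr ≃ₗ[SymmetricAlgebra ℂ (pPrime p)] Ψ.Gr,
        ∀ v, e v = hT.grMap v := by
  let e := LinearEquiv.ofBijective T ⟨h.injective, h.surjective⟩
  have he : ∀ v, e v = T v := fun _ => rfl
  -- Bijectivity of `T` alone would not give this; it is the strictness of `T`.
  have he' : Preserves Ψ Φ e.symm.toLinearMap := fun n w hw =>
    h.mem_of_apply_mem (by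
      rw [LinearEquiv.coe_coe, ← he, e.apply_symm_apply]
      exact hw)
  have hT : Preserves Φ Ψ e.toLinearMap := h.preserves
  exact ⟨⟨e, he⟩, h.preserves, LinearEquiv.ofBijective h.preserves.grMap (hT.grMap_bijective he'),
    fun _ => rfl⟩

end grEquiv

/-! ### The parabolic decompositions of `sp(2p, ℂ)` -/

section Parabolic

open Matrix

variable {p : ℕ}

theorem sp_exists_blocks (A : sp p) : ∃ X Y Z : Matrix (Fin p) (Fin p) ℂ,
    Yᵀ = Y ∧ Zᵀ = Z ∧ A.1 = fromBlocks X Y Z (-Xᵀ) := by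
  have h := A.2
  rw [← fromBlocks_toBlocks A.1, mem_sp_iff] at h
  refine ⟨A.1.toBlocks₁₁, A.1.toBlocks₁₂, A.1.toBlocks₂₁, h.2.1, h.2.2, ?_⟩
  rw [← h.1, fromBlocks_toBlocks]

/-- Expand the triple bracket into words with one letter x and three letters from P: two letters
from P are always adjacent, so every word vanishes. -/
theorem isAbelianCompl_of_mul_eq_zero {q : LieSubalgebra ℂ (sp p)} {P : Submodule ℂ (sp p)}
    (hc : IsCompl q.toSubmodule P) (hP : ∀ z ∈ P, ∀ z' ∈ P, z.1 * z'.1 = 0) :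
    IsAbelianCompl q P where
  isCompl := hc
  lie_eq_zero z hz z' hz' := by
    apply Subtype.ext
    rw [sp_bracket, hP z hz z' hz', hP z' hz' z hz, sub_zero]
    rfl
  lie_lie_lie_eq_zero x z hz z' hz' z'' hz'' := by
    apply Subtype.ext
    have h1 := hP z hz z' hz'
    have h2 := hP z' hz' z hz
    have h3 := hP z hz z'' hz''
    have h4 := hP z' hz' z'' hz''
    have h5 := hP z'' hz'' z hz
    have h6 := hP z'' hz'' z' hz'
    -- After two brackets only the words with x in the middle survive.
    have e : ((x.1 * z.1 - z.1 * x.1) * z'.1 - z'.1 * (x.1 * z.1 - z.1 * x.1)) =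
        -(z.1 * x.1 * z'.1) - z'.1 * x.1 * z.1 := by
      rw [sub_mul, mul_sub, mul_assoc x.1, h1, ← mul_assoc z'.1 z.1, h2]
      simp [mul_assoc]
    rw [sp_bracket, sp_bracket, sp_bracket, e, sub_mul, mul_sub, neg_mul, mul_neg,
      mul_assoc (z.1 * x.1), h4, mul_assoc (z'.1 * x.1), h3, ← mul_assoc z''.1,
      ← mul_assoc z''.1 (z'.1 * x.1), ← mul_assoc z''.1 z.1, h5, ← mul_assoc z''.1 z'.1, h6]
    simp

theorem isAbelianCompl_qPlus (p : ℕ) : IsAbelianCompl (qPlus p) (pMinus p) := by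
  refine isAbelianCompl_of_mul_eq_zero ⟨?_, ?_⟩ ?_
  · rw [Submodule.disjoint_def]
    rintro A hA ⟨Z, -, hZ⟩
    obtain ⟨X, Y, -, hA⟩ := (mem_sup_pPlus_iff A).1 hA
    apply Subtype.ext
    rw [hA, fromBlocks_inj] at hZ
    rw [hA, hZ.1, hZ.2.1]
    simp
  · rw [codisjoint_iff_le_sup]
    intro A _
    obtain ⟨X, Y, Z, hY, hZ, hA⟩ := sp_exists_blocks A
    refine Submodule.mem_sup.2 ⟨⟨fromBlocks X Y 0 (-Xᵀ), by simp [mem_sp_iff, hY]⟩,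
      (mem_sup_pPlus_iff _).2 ⟨X, Y, hY, rfl⟩,
      ⟨fromBlocks 0 0 Z 0, by simp [mem_sp_iff, hZ]⟩, ⟨Z, hZ, rfl⟩,
      Subtype.ext (by simp [hA, fromBlocks_add])⟩
  · rintro z ⟨Z, -, hz⟩ z' ⟨Z', -, hz'⟩
    simp [hz, hz', fromBlocks_multiply]

theorem isAbelianCompl_qMinus (p : ℕ) : IsAbelianCompl (qMinus p) (pPlus p) := by
  refine isAbelianCompl_of_mul_eq_zero ⟨?_, ?_⟩ ?_
  · rw [Submodule.disjoint_def]
    rintro A hA ⟨Z, -, hZ⟩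
    obtain ⟨X, Y, -, hA⟩ := (mem_sup_pMinus_iff A).1 hA
    apply Subtype.ext
    rw [hA, fromBlocks_inj] at hZ
    rw [hA, hZ.1, hZ.2.2.1]
    simp
  · rw [codisjoint_iff_le_sup]
    intro A _
    obtain ⟨X, Y, Z, hY, hZ, hA⟩ := sp_exists_blocks A
    refine Submodule.mem_sup.2 ⟨⟨fromBlocks X 0 Z (-Xᵀ), by simp [mem_sp_iff, hZ]⟩,
      (mem_sup_pMinus_iff _).2 ⟨X, Z, hZ, rfl⟩,
      ⟨fromBlocks 0 Y 0 0, by simp [mem_sp_iff, hY]⟩, ⟨Y, hY, rfl⟩,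
      Subtype.ext (by simp [hA, fromBlocks_add])⟩
  · rintro z ⟨Z, -, hz⟩ z' ⟨Z', -, hz'⟩
    simp [hz, hz', fromBlocks_multiply]

theorem mem_qPlus_of_mem_kLie {x : sp p} (hx : x ∈ kLie p) : x ∈ qPlus p :=
  Submodule.mem_sup_left (S := (kLie p).toSubmodule) hx

theorem mem_qPlus_of_mem_pPlus {x : sp p} (hx : x ∈ pPlus p) : x ∈ qPlus p :=
  Submodule.mem_sup_right (S := (kLie p).toSubmodule) hx

theorem mem_qMinus_of_mem_kLie {x : sp p} (hx : x ∈ kLie p) : x ∈ qMinus p :=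
  Submodule.mem_sup_left (S := (kLie p).toSubmodule) hx

theorem mem_qMinus_of_mem_pMinus {x : sp p} (hx : x ∈ pMinus p) : x ∈ qMinus p :=
  Submodule.mem_sup_right (S := (kLie p).toSubmodule) hx

end Parabolic

/-! ### The filtrations of the induced modules -/

section Filtrations

/-- The shift `k` is used with the values 0 (elements that keep the degree) and 1 (elements that
raise it). -/
theorem pow_smul_mem {L N : Type*} [LieRing L] [LieAlgebra ℂ L] [AddCommGroup N] [Module ℂ N]
    [Module (U L) N] [IsScalarTower ℂ (U L) N] {S : Submodule ℂ L} {G : ℕ → Submodule ℂ N} {k : ℕ}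
    (h : ∀ x ∈ S, ∀ n, ∀ v ∈ G n, ιU L x • v ∈ G (n + k)) (r : ℕ) {u : U L}
    (hu : u ∈ S.map (ιU L) ^ r) {n : ℕ} {v : N} (hv : v ∈ G n) : u • v ∈ G (n + k * r) := by
  induction r generalizing u with
  | zero =>
    rw [pow_zero] at hu
    obtain ⟨c, rfl⟩ := Submodule.mem_one.1 hu
    rw [algebraMap_smul]
    exact Submodule.smul_mem _ c hv
  | succ r ih =>
    rw [pow_succ'] at hu
    induction hu using Submodule.mul_induction_on' with
    | add a _ b _ ha hb => rw [add_smul]; exact add_mem ha hb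
    | mem_mul_mem a ha u hu =>
      obtain ⟨x, hx, rfl⟩ := ha
      rw [mul_smul]
      rw [Nat.mul_succ, ← add_assoc]
      exact h x hx _ _ (ih hu)

theorem Uk_smul_mem {p : ℕ} {N : Type*} [AddCommGroup N] [Module ℂ N] [Module (U (sp p)) N]
    [IsScalarTower ℂ (U (sp p)) N] {G : Submodule ℂ N}
    (h : ∀ x ∈ kLie p, ∀ v ∈ G, ιU (sp p) x • v ∈ G) {u : U (sp p)} (hu : u ∈ Uk p) {v : N}
    (hv : v ∈ G) : u • v ∈ G := by
  obtain ⟨a, rfl⟩ := hu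
  let S : Subalgebra ℂ (U (kLie p)) :=
    { carrier := {a | ∀ v ∈ G, kToG p a • v ∈ G}
      mul_mem' := by
        intro a b ha hb v hv
        rw [map_mul, mul_smul]
        exact ha _ (hb _ hv)
      add_mem' := by
        intro a b ha hb v hv
        rw [map_add, add_smul]
        exact add_mem (ha _ hv) (hb _ hv)
      algebraMap_mem' := by
        intro r v hv
        rw [AlgHom.commutes, algebraMap_smul]
        exact G.smul_mem r hv }
  exact U.mem_of_ι_mem S (fun x v hv => by rw [envMap_ι]; exact h _ x.2 v hv) a v hv

variable {p : ℕ}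

theorem one_mem_Uk : (1 : U (sp p)) ∈ Uk p := (kToG p).range.one_mem

theorem pow_mul_pow_le (r s n : ℕ) (h : r + s ≤ n) :
    imU (pMinus p) ^ r * imU (pPlus p) ^ s ≤ M p n * Uk p := by
  intro u hu
  rw [← mul_one u]
  exact Submodule.mul_mem_mul
    (Submodule.mem_iSup_of_mem r (Submodule.mem_iSup_of_mem s (Submodule.mem_iSup_of_mem h hu)))
    one_mem_Uk

variable {A X : Type*} [Ring A] [Algebra ℂ A] [AddCommGroup X] [Module ℂ X]
  (φ : A →ₐ[ℂ] U (sp p)) (ρ : A →ₐ[ℂ] Module.End ℂ X)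

theorem mk_mem_inducedFil {r s n : ℕ} (h : r + s ≤ n) {u v : U (sp p)}
    (hu : u ∈ imU (pMinus p) ^ r) (hv : v ∈ imU (pPlus p) ^ s) (x : X) :
    Induced.mk φ ρ (u * v) x ∈ (inducedFil φ ρ).F n :=
  Submodule.apply_mem_map₂ _ (pow_mul_pow_le r s n h (Submodule.mul_mem_mul hu hv))
    Submodule.mem_top

theorem inducedFil_le {n : ℕ} {S : Submodule ℂ (Induced φ ρ)}
    (h : ∀ r s, r + s ≤ n → ∀ u ∈ imU (pMinus p) ^ r, ∀ v ∈ imU (pPlus p) ^ s, ∀ w ∈ Uk p, ∀ x,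
      Induced.mk φ ρ (u * (v * w)) x ∈ S) : (inducedFil φ ρ).F n ≤ S := by
  refine Submodule.map₂_le.2 fun y hy x _ => ?_
  suffices H : M p n * Uk p ≤ S.comap ((Induced.mk φ ρ).flip x) from H hy
  rw [M_mul_Uk]
  refine iSup_le fun r => iSup_le fun s => iSup_le fun hrs => Submodule.mul_le.2 fun u hu y hy => ?_
  suffices H : imU (pPlus p) ^ s * Uk p ≤
      S.comap ((Induced.mk φ ρ).flip x ∘ₗ LinearMap.mulLeft ℂ u) from H hy
  exact Submodule.mul_le.2 fun v hv w hw => h r s hrs u hu v hv w hw x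

/-- The elements of U(𝔤') that preserve the union of the filtration form a subalgebra. It contains
𝔤' = 𝔨' + 𝔭⁺ + 𝔭⁻, hence is everything, and the union contains 1 ⊗ X. -/
theorem exists_mem_inducedFil (v : Induced φ ρ) : ∃ n, v ∈ (inducedFil φ ρ).F n := by
  have hmono : Monotone (inducedFil φ ρ).F := monotone_nat_of_le_succ (inducedFil φ ρ).mono
  have hU : ∀ (u : U (sp p)) (v : Induced φ ρ), (∃ n, v ∈ (inducedFil φ ρ).F n) →
      ∃ n, u • v ∈ (inducedFil φ ρ).F n := by
    intro u
    let S : Subalgebra ℂ (U (sp p)) :=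
      { carrier := {u | ∀ v : Induced φ ρ, (∃ n, v ∈ (inducedFil φ ρ).F n) →
          ∃ n, u • v ∈ (inducedFil φ ρ).F n}
        mul_mem' := by
          intro a b ha hb v hv
          rw [mul_smul]
          exact ha _ (hb _ hv)
        add_mem' := by
          intro a b ha hb v hv
          obtain ⟨m, hm⟩ := ha v hv
          obtain ⟨n, hn⟩ := hb v hv
          rw [add_smul]
          exact ⟨m + n, add_mem (hmono (Nat.le_add_right m n) hm) (hmono (Nat.le_add_left n m) hn)⟩
        algebraMap_mem' := by
          rintro r v ⟨n, hn⟩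
          rw [algebraMap_smul]
          exact ⟨n, Submodule.smul_mem _ r hn⟩ }
    refine U.mem_of_ι_mem S ?_ u
    rintro x v ⟨n, hn⟩
    obtain ⟨⟨y, hy⟩, z, hz, rfl⟩ := (isAbelianCompl_qPlus p).exists_decomp x
    obtain ⟨a, ha, b, hb, rfl⟩ := Submodule.mem_sup.1 hy
    refine ⟨n + 1, ?_⟩
    rw [map_add, map_add, add_smul, add_smul]
    exact add_mem (add_mem ((inducedFil φ ρ).mono n ((inducedFil φ ρ).k_smul a ha n v hn))
      ((inducedFil φ ρ).p_smul b (Submodule.mem_sup_left hb) n v hn))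
      ((inducedFil φ ρ).p_smul z (Submodule.mem_sup_right hz) n v hn)
  obtain ⟨t, rfl⟩ := Submodule.mkQ_surjective (balancedRel φ ρ) v
  induction t using TensorProduct.induction_on with
  | zero => exact ⟨0, by rw [map_zero]; exact zero_mem _⟩
  | add a b ha hb =>
    obtain ⟨m, hm⟩ := ha
    obtain ⟨n, hn⟩ := hb
    refine ⟨m + n, ?_⟩
    rw [map_add]
    exact add_mem (hmono (Nat.le_add_right m n) hm) (hmono (Nat.le_add_left n m) hn)
  | tmul u x =>
    obtain ⟨n, hn⟩ := hU u (Induced.mk φ ρ 1 x) ⟨0, by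
      have := mk_mem_inducedFil φ ρ (r := 0) (s := 0) le_rfl (u := 1) (v := 1)
        (by rw [pow_zero]; exact Submodule.one_le.1 le_rfl)
        (by rw [pow_zero]; exact Submodule.one_le.1 le_rfl) x
      rwa [mul_one] at this⟩
    rw [Induced.smul_mk, mul_one] at hn
    exact ⟨n, hn⟩

/-- Here `i` and `k` bound how much 𝔭⁻ and 𝔭⁺ raise the degree in P: the pair is (1, 0) for 𝔮⁺ and
(0, 1) for 𝔮⁻. A product from (𝔭⁻)^r (𝔭⁺)^s U(𝔨') then has degree at most i r + k s ≤ r + s. -/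
theorem inducedFil_le_degLE {P : Submodule ℂ (sp p)} {i k : ℕ} (hi : i ≤ 1) (hk : k ≤ 1)
    (h0 : ∀ x ∈ kLie p, ∀ n, ∀ v ∈ degLE φ ρ P n, ιU (sp p) x • v ∈ degLE φ ρ P n)
    (hm : ∀ x ∈ pMinus p, ∀ n, ∀ v ∈ degLE φ ρ P n, ιU (sp p) x • v ∈ degLE φ ρ P (n + i))
    (hp : ∀ x ∈ pPlus p, ∀ n, ∀ v ∈ degLE φ ρ P n, ιU (sp p) x • v ∈ degLE φ ρ P (n + k)) (n : ℕ) :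
    (inducedFil φ ρ).F n ≤ degLE φ ρ P n := by
  refine inducedFil_le φ ρ fun r s hrs u hu v hv w hw x => ?_
  have h1 : Induced.mk φ ρ 1 x ∈ degLE φ ρ P 0 :=
    mk_mem_degLE φ ρ le_rfl (by rw [pow_zero]; exact Submodule.one_le.1 le_rfl) x
  have h2 := pow_smul_mem hm r hu (pow_smul_mem hp s hv (Uk_smul_mem (fun y hy => h0 y hy 0) hw h1))
  rw [Induced.smul_mk, Induced.smul_mk, Induced.smul_mk, mul_one] at h2
  refine degLE_mono φ ρ ?_ h2
  have := Nat.mul_le_mul_right s hk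
  have := Nat.mul_le_mul_right r hi
  omega

/-- The factors from 𝔭⁺ and 𝔨' lie in 𝔮⁺ and do not raise the degree, so only those from 𝔭⁻ count.
-/
theorem inducedFil_qPlus (ρ : U (qPlus p) →ₐ[ℂ] Module.End ℂ X) (n : ℕ) :
    (inducedFil (qPlusToG p) ρ).F n = degLE (qPlusToG p) ρ (pMinus p) n := by
  apply le_antisymm
  · exact inducedFil_le_degLE _ ρ (i := 1) (k := 0) le_rfl zero_le_one
      (fun x hx n v hv => (isAbelianCompl_qPlus p).smul_mem_degLE ρ
        ⟨x, mem_qPlus_of_mem_kLie hx⟩ hv)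
      (fun x hx n v hv => smul_mem_degLE_succ _ ρ hx hv)
      (fun x hx n v hv => (isAbelianCompl_qPlus p).smul_mem_degLE ρ
        ⟨x, mem_qPlus_of_mem_pPlus hx⟩ hv) n
  · refine degLE_le _ ρ fun j hj u hu x => ?_
    have := mk_mem_inducedFil (qPlusToG p) ρ (r := j) (s := 0) (n := n) (by omega) hu (v := 1)
      (by rw [pow_zero]; exact Submodule.one_le.1 le_rfl) x
    rwa [mul_one] at this

theorem inducedFil_qMinus (ρ : U (qMinus p) →ₐ[ℂ] Module.End ℂ X) (n : ℕ) :
    (inducedFil (qMinusToG p) ρ).F n = degLE (qMinusToG p) ρ (pPlus p) n := by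
  apply le_antisymm
  · exact inducedFil_le_degLE _ ρ (i := 0) (k := 1) zero_le_one le_rfl
      (fun x hx n v hv => (isAbelianCompl_qMinus p).smul_mem_degLE ρ
        ⟨x, mem_qMinus_of_mem_kLie hx⟩ hv)
      (fun x hx n v hv => (isAbelianCompl_qMinus p).smul_mem_degLE ρ
        ⟨x, mem_qMinus_of_mem_pMinus hx⟩ hv)
      (fun x hx n v hv => smul_mem_degLE_succ _ ρ hx hv) n
  · refine degLE_le _ ρ fun j hj u hu x => ?_
    have := mk_mem_inducedFil (qMinusToG p) ρ (r := 0) (s := j) (n := n) (by omega) (u := 1)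
      (by rw [pow_zero]; exact Submodule.one_le.1 le_rfl) hu x
    rwa [one_mul] at this

end Filtrations

/-! ### Commutative subalgebras acting on tensor products -/

section TensorAction

theorem DiagTensor.mk_smul_left {L X Y : Type*} [LieRing L] [LieAlgebra ℂ L]
    [AddCommGroup X] [Module ℂ X] [LieRingModule L X] [LieModule ℂ L X]
    [AddCommGroup Y] [Module ℂ Y] [LieRingModule L Y] [LieModule ℂ L Y] (c : ℂ) (v : X) (w : Y) :
    DiagTensor.mk L X Y (c • v) w = c • DiagTensor.mk L X Y v w :=
  LinearMap.map_smul₂ (DiagTensor.mk L X Y) c v w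

theorem Induced.algebraMap_mk {A B M : Type*} [Ring A] [Algebra ℂ A] [Ring B] [Algebra ℂ B]
    [AddCommGroup M] [Module ℂ M] (φ : A →ₐ[ℂ] B) (ρ : A →ₐ[ℂ] Module.End ℂ M) (c : ℂ) (m : M) :
    Induced.mk φ ρ (algebraMap ℂ B c) m = c • Induced.mk φ ρ 1 m := by
  rw [Algebra.algebraMap_eq_smul_one]
  exact LinearMap.map_smul₂ (Induced.mk φ ρ) c 1 m

variable {A A' X Y : Type*} [Ring A] [Algebra ℂ A] [Ring A'] [Algebra ℂ A'] [AddCommGroup X]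
  [Module ℂ X] [AddCommGroup Y] [Module ℂ Y]

theorem Induced.ι_smul_sub_mk_mk {L : Type*} [LieRing L] [LieAlgebra ℂ L] (φ : A →ₐ[ℂ] U L)
    (ρ : A →ₐ[ℂ] Module.End ℂ X) (φ' : A' →ₐ[ℂ] U L) (ρ' : A' →ₐ[ℂ] Module.End ℂ Y) (z : L) (u : U L)
    (x : X) (w : Induced φ' ρ') (v : DiagTensor L (Induced φ ρ) (Induced φ' ρ')) :
    ιU L z • (v - DiagTensor.mk L (Induced φ ρ) (Induced φ' ρ') (Induced.mk φ ρ u x) w) +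
        DiagTensor.mk L (Induced φ ρ) (Induced φ' ρ') (Induced.mk φ ρ u x) (ιU L z • w) =
      ιU L z • v -
        DiagTensor.mk L (Induced φ ρ) (Induced φ' ρ') (Induced.mk φ ρ (ιU L z * u) x) w := by
  rw [smul_sub, DiagTensor.ι_smul_mk, Induced.lie_def, Induced.lie_def, Induced.smul_mk]
  abel

/-- Induction step for the leading-term computation: acting by z raises the old error by one degree,
and by Leibniz the only new error is the term in which z acts on the second factor. -/
theorem tensorFil_smul_sub_mem_prev {p : ℕ} {φ : A →ₐ[ℂ] U (sp p)} {ρ : A →ₐ[ℂ] Module.End ℂ X}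
    {φ' : A' →ₐ[ℂ] U (sp p)} {ρ' : A' →ₐ[ℂ] Module.End ℂ Y}
    {Φ : CartanFiltration p (Induced φ ρ)} {Ψ : CartanFiltration p (Induced φ' ρ')} {z : sp p}
    (hz : z ∈ pPrime p) {u u' : U (sp p)} (hu : u' = ιU (sp p) z * u) {n : ℕ} {x : X}
    {v : DiagTensor (sp p) (Induced φ ρ) (Induced φ' ρ')} {w : Induced φ' ρ'}
    (h1 : u • v - DiagTensor.mk (sp p) (Induced φ ρ) (Induced φ' ρ') (Induced.mk φ ρ u x) w ∈
      (tensorFil Φ Ψ).prev n)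
    (h2 : DiagTensor.mk (sp p) (Induced φ ρ) (Induced φ' ρ') (Induced.mk φ ρ u x)
      (ιU (sp p) z • w) ∈ (tensorFil Φ Ψ).F n) :
    u' • v - DiagTensor.mk (sp p) (Induced φ ρ) (Induced φ' ρ') (Induced.mk φ ρ u' x) w ∈
      (tensorFil Φ Ψ).prev (n + 1) := by
  subst hu
  rw [mul_smul, ← Induced.ι_smul_sub_mk_mk]
  exact add_mem ((tensorFil Φ Ψ).prev_p_smul hz n _ h1) h2

/-- If `P` kills `v`, then `S(P)` acts on `v ⊗ w` through the second factor. -/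
theorem IsAbelianCompl.symU_smul_mk_of_lie_eq_zero {L : Type*} [LieRing L] [LieAlgebra ℂ L]
    {q : LieSubalgebra ℂ L} {P : Submodule ℂ L} (h : IsAbelianCompl q P) {φ : A →ₐ[ℂ] U L}
    {ρ : A →ₐ[ℂ] Module.End ℂ X} {φ' : A' →ₐ[ℂ] U L} {ρ' : A' →ₐ[ℂ] Module.End ℂ Y}
    {v : Induced φ ρ} (hv : ∀ z ∈ P, ⁅z, v⁆ = 0) (t : SymmetricAlgebra ℂ P) (w : Induced φ' ρ') :
    h.symU t • DiagTensor.mk L (Induced φ ρ) (Induced φ' ρ') v w =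
      DiagTensor.mk L (Induced φ ρ) (Induced φ' ρ') v (h.symU t • w) := by
  induction t using SymmetricAlgebra.induction generalizing w with
  | algebraMap r =>
    rw [AlgHom.commutes, algebraMap_smul, algebraMap_smul]
    exact ((DiagTensor.mk L (Induced φ ρ) (Induced φ' ρ') v).map_smul r w).symm
  | ι y =>
    have e := LinearMap.map_zero₂ (DiagTensor.mk L (Induced φ ρ) (Induced φ' ρ')) w
    rw [h.symU_ι, DiagTensor.ι_smul_mk, hv y y.2, e, zero_add, Induced.lie_def]
  | mul a b ha hb => rw [map_mul, mul_smul, mul_smul, hb, ha]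
  | add a b ha hb => rw [map_add, add_smul, add_smul, map_add, ha, hb]

/-- `S(P)` acts on `(1 ⊗ x) ⊗ w` through the first factor, up to terms of lower degree. -/
theorem IsAbelianCompl.symU_smul_mk_sub_mem {p : ℕ} {q : LieSubalgebra ℂ (sp p)}
    {P : Submodule ℂ (sp p)} (h : IsAbelianCompl q P) (hP : P ≤ pPrime p) {φ : A →ₐ[ℂ] U (sp p)}
    {ρ : A →ₐ[ℂ] Module.End ℂ X} {φ' : A' →ₐ[ℂ] U (sp p)} {ρ' : A' →ₐ[ℂ] Module.End ℂ Y} {x : X}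
    {Φ : CartanFiltration p (Induced φ ρ)} {Ψ : CartanFiltration p (Induced φ' ρ')}
    (hx : ∀ r, ∀ s ∈ (SymmetricAlgebra.ι ℂ P).range ^ r, Induced.mk φ ρ (h.symU s) x ∈ Φ.F r) (k : ℕ)
    (hk : ∀ z ∈ P, ∀ w ∈ Ψ.F k, ιU (sp p) z • w ∈ Ψ.F k) (r : ℕ) {s : SymmetricAlgebra ℂ P}
    (hs : s ∈ (SymmetricAlgebra.ι ℂ P).range ^ r) {w : Induced φ' ρ'} (hw : w ∈ Ψ.F k) :
    h.symU s • DiagTensor.mk (sp p) (Induced φ ρ) (Induced φ' ρ') (Induced.mk φ ρ 1 x) w -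
      DiagTensor.mk (sp p) (Induced φ ρ) (Induced φ' ρ') (Induced.mk φ ρ (h.symU s) x) w ∈
        (tensorFil Φ Ψ).prev (r + k) := by
  induction r generalizing s with
  | zero =>
    rw [pow_zero] at hs
    obtain ⟨c, rfl⟩ := Submodule.mem_one.1 hs
    rw [AlgHom.commutes, algebraMap_smul, Induced.algebraMap_mk, DiagTensor.mk_smul_left, sub_self]
    exact zero_mem _
  | succ r ih =>
    rw [pow_succ'] at hs
    induction hs using Submodule.mul_induction_on' with
    | add a _ b _ ha hb =>
      rw [map_add, add_smul, LinearMap.map_add₂ (Induced.mk φ ρ),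
        LinearMap.map_add₂ (DiagTensor.mk (sp p) (Induced φ ρ) (Induced φ' ρ')), add_sub_add_comm]
      exact add_mem ha hb
    | mem_mul_mem a ha s hs =>
      obtain ⟨z, rfl⟩ := ha
      -- By `hk` acting on w costs no degree, so this term stays in degree r + k, one below the
      -- leading term.
      have h2 : DiagTensor.mk (sp p) (Induced φ ρ) (Induced φ' ρ') (Induced.mk φ ρ (h.symU s) x)
          (ιU (sp p) z • w) ∈ (tensorFil Φ Ψ).F (r + k) :=
        Submodule.mem_iSup_of_mem r (Submodule.mem_iSup_of_mem k (Submodule.mem_iSup_of_mem le_rfl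
          (Submodule.apply_mem_map₂ _ (hx r s hs) (hk z z.2 w hw))))
      rw [show r + 1 + k = r + k + 1 by omega]
      have e : h.symU (SymmetricAlgebra.ι ℂ P z * s) = ιU (sp p) z * h.symU s := by
        rw [map_mul, h.symU_ι]
      exact tensorFil_smul_sub_mem_prev (hP z.2) e (ih hs) h2

end TensorAction

/-! ### The approximate inverse of `T` -/

section Inverse

variable (p : ℕ) (E F : Type*)
  [AddCommGroup E] [Module ℂ E] [LieRingModule (kLie p) E] [LieModule ℂ (kLie p) E]
  [AddCommGroup F] [Module ℂ F] [LieRingModule (kLie p) F] [LieModule ℂ (kLie p) F]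

/-- The tensor `u ⊗ w` in `V`. -/
abbrev V.mk : U (sp p) →ₗ[ℂ] E ⊗[ℂ] F →ₗ[ℂ] V p E F :=
  Induced.mk (kToG p) (envAct (kLie p) (E ⊗[ℂ] F))

/-- The tensor `u ⊗ e` in `V_E`. -/
abbrev VPlus.mk : U (sp p) →ₗ[ℂ] E →ₗ[ℂ] VPlus p E := Induced.mk (qPlusToG p) (plusAct p E)

/-- The tensor `u ⊗ f` in `V_F`. -/
abbrev VMinus.mk : U (sp p) →ₗ[ℂ] F →ₗ[ℂ] VMinus p F := Induced.mk (qMinusToG p) (minusAct p F)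

/-- The tensor `v ⊗ w` in `V_E ⊗ V_F`. -/
abbrev VTensor.mk : VPlus p E →ₗ[ℂ] VMinus p F →ₗ[ℂ] VTensor p E F :=
  DiagTensor.mk (sp p) (VPlus p E) (VMinus p F)

/-- The homomorphism `S(𝔭⁻) → U(𝔤')`. -/
abbrev symMinus : SymmetricAlgebra ℂ (pMinus p) →ₐ[ℂ] U (sp p) := (isAbelianCompl_qPlus p).symU

/-- The homomorphism `S(𝔭⁺) → U(𝔤')`. -/
abbrev symPlus : SymmetricAlgebra ℂ (pPlus p) →ₐ[ℂ] U (sp p) := (isAbelianCompl_qMinus p).symU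

/-- Stated through the values of `c` and `d` so that left inverses can be inserted without
identifying X and Y with tensor products. -/
theorem exists_tensor_lift {R A B C E F X Y Z : Type*} [CommRing R] [AddCommGroup A] [Module R A]
    [AddCommGroup B] [Module R B] [AddCommGroup C] [Module R C] [AddCommGroup E] [Module R E]
    [AddCommGroup F] [Module R F] [AddCommGroup X] [Module R X] [AddCommGroup Y] [Module R Y]
    [AddCommGroup Z] [Module R Z] (c : X →ₗ[R] A ⊗[R] E) (d : Y →ₗ[R] B ⊗[R] F)
    (m : A →ₗ[R] B →ₗ[R] C) (g : C →ₗ[R] E ⊗[R] F →ₗ[R] Z) :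
    ∃ k : X ⊗[R] Y →ₗ[R] Z, ∀ x y a e b f, c x = a ⊗ₜ e → d y = b ⊗ₜ f →
      k (x ⊗ₜ y) = g (m a b) (e ⊗ₜ f) := by
  refine ⟨TensorProduct.lift (g ∘ₗ TensorProduct.lift m) ∘ₗ
      (TensorProduct.tensorTensorTensorComm R A E B F).toLinearMap ∘ₗ TensorProduct.map c d,
    fun x y a e b f hx hy => ?_⟩
  rw [LinearMap.comp_apply, LinearMap.comp_apply, TensorProduct.map_tmul, hx, hy,
    LinearEquiv.coe_coe, TensorProduct.tensorTensorTensorComm_tmul]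
  rfl

/-- The left inverses for V_E and V_F read off s ⊗ e and t ⊗ f, which makes the formula well
defined. The factor from 𝔭⁻ stands on the left, as in `M`. -/
theorem exists_inverse : ∃ b : VTensor p E F →ₗ[ℂ] V p E F, ∀ s t e f,
    b (VTensor.mk p E F (VPlus.mk p E (symMinus p s) e) (VMinus.mk p F (symPlus p t) f)) =
      V.mk p E F (symMinus p s * symPlus p t) (e ⊗ₜ f) := by
  obtain ⟨c, hc⟩ := (isAbelianCompl_qPlus p).exists_leftInverse (plusAct p E)
  obtain ⟨d, hd⟩ := (isAbelianCompl_qMinus p).exists_leftInverse (minusAct p F)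
  obtain ⟨b, hb⟩ := exists_tensor_lift c d
    ((LinearMap.mul ℂ (U (sp p))).compl₁₂ (symMinus p).toLinearMap (symPlus p).toLinearMap)
    (V.mk p E F)
  exact ⟨b, fun s t e f => hb _ _ s e t f (hc s e) (hd t f)⟩

/-! ### Spanning vectors of the filtrations and the leading term of `T`. -/

variable {p E F}

theorem filVTensor_le {n : ℕ} {S : Submodule ℂ (VTensor p E F)}
    (h : ∀ r k, r + k ≤ n → ∀ s ∈ (SymmetricAlgebra.ι ℂ (pMinus p)).range ^ r,
      ∀ t ∈ (SymmetricAlgebra.ι ℂ (pPlus p)).range ^ k, ∀ e f,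
      VTensor.mk p E F (VPlus.mk p E (symMinus p s) e) (VMinus.mk p F (symPlus p t) f) ∈ S) :
    (filVTensor p E F).F n ≤ S := by
  refine iSup_le fun r => iSup_le fun k => iSup_le fun hrk => Submodule.map₂_le.2 fun v hv w hw => ?_
  rw [inducedFil_qPlus] at hv
  rw [inducedFil_qMinus] at hw
  suffices H : degLE (qPlusToG p) (plusAct p E) (pMinus p) r ≤
      S.comap ((VTensor.mk p E F).flip w) from H hv
  refine degLE_le _ _ fun i hi u hu e => ?_
  rw [← (isAbelianCompl_qPlus p).map_symU] at hu
  obtain ⟨s, hs, rfl⟩ := hu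
  suffices H : degLE (qMinusToG p) (minusAct p F) (pPlus p) k ≤
      S.comap (VTensor.mk p E F (VPlus.mk p E (symMinus p s) e)) from H hw
  refine degLE_le _ _ fun j hj u hu f => ?_
  rw [← (isAbelianCompl_qMinus p).map_symU] at hu
  obtain ⟨t, ht, rfl⟩ := hu
  exact h i j (by omega) s hs t ht e f

theorem mk_mem_filVTensor {r k n : ℕ} (h : r + k ≤ n) {v : VPlus p E} {w : VMinus p F}
    (hv : v ∈ degLE (qPlusToG p) (plusAct p E) (pMinus p) r)
    (hw : w ∈ degLE (qMinusToG p) (minusAct p F) (pPlus p) k) :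
    VTensor.mk p E F v w ∈ (filVTensor p E F).F n := by
  rw [← inducedFil_qPlus] at hv
  rw [← inducedFil_qMinus] at hw
  exact Submodule.mem_iSup_of_mem r (Submodule.mem_iSup_of_mem k (Submodule.mem_iSup_of_mem h
    (Submodule.apply_mem_map₂ _ hv hw)))

theorem symMinus_mem {r : ℕ} {s : SymmetricAlgebra ℂ (pMinus p)}
    (hs : s ∈ (SymmetricAlgebra.ι ℂ (pMinus p)).range ^ r) : symMinus p s ∈ imU (pMinus p) ^ r := by
  rw [imU, ← (isAbelianCompl_qPlus p).map_symU]
  exact ⟨s, hs, rfl⟩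

theorem symPlus_mem {r : ℕ} {s : SymmetricAlgebra ℂ (pPlus p)}
    (hs : s ∈ (SymmetricAlgebra.ι ℂ (pPlus p)).range ^ r) : symPlus p s ∈ imU (pPlus p) ^ r := by
  rw [imU, ← (isAbelianCompl_qMinus p).map_symU]
  exact ⟨s, hs, rfl⟩

/-- `𝔭⁺` kills `1 ⊗ E`. -/
theorem pPlus_lie_mk_one (y : pPlus p) (e : E) : ⁅(y : sp p), VPlus.mk p E 1 e⁆ = 0 := by
  have hy : qPlusProj p ⟨y, mem_qPlus_of_mem_pPlus y.2⟩ = 0 :=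
    kProj_pPrime (Submodule.mem_sup_left y.2)
  have h : plusAct p E (ιU (qPlus p) ⟨y, mem_qPlus_of_mem_pPlus y.2⟩) = 0 := by
    rw [AlgHom.comp_apply, envMap_ι, hy, map_zero, map_zero]
  have e1 := Induced.lie_one (qPlusToG p) (plusAct p E)
    (envMap_ι (qPlus p).incl ⟨y, mem_qPlus_of_mem_pPlus y.2⟩) e
  rw [h, LinearMap.zero_apply, map_zero] at e1
  exact e1

theorem T_mk (u : U (sp p)) (e : E) (f : F) : T p E F (V.mk p E F u (e ⊗ₜ f)) =
    u • VTensor.mk p E F (VPlus.mk p E 1 e) (VMinus.mk p F 1 f) := rfl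

/-- The heart of the proof. First t passes to the second factor without error, because 𝔭⁺ kills 1 ⊗
e. Then s goes to the first factor up to lower degree, because 𝔭⁻ ⊂ 𝔮⁻ does not raise degrees in
V_F. -/
theorem T_mk_sub_mem {r k : ℕ} {s : SymmetricAlgebra ℂ (pMinus p)}
    (hs : s ∈ (SymmetricAlgebra.ι ℂ (pMinus p)).range ^ r) {t : SymmetricAlgebra ℂ (pPlus p)}
    (ht : t ∈ (SymmetricAlgebra.ι ℂ (pPlus p)).range ^ k) (e : E) (f : F) :
    T p E F (V.mk p E F (symMinus p s * symPlus p t) (e ⊗ₜ f)) -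
      VTensor.mk p E F (VPlus.mk p E (symMinus p s) e) (VMinus.mk p F (symPlus p t) f) ∈
        (filVTensor p E F).prev (r + k) := by
  have h1 : symPlus p t • VTensor.mk p E F (VPlus.mk p E 1 e) (VMinus.mk p F 1 f) =
      VTensor.mk p E F (VPlus.mk p E 1 e) (VMinus.mk p F (symPlus p t) f) := by
    have h0 : symPlus p t • VMinus.mk p F 1 f = VMinus.mk p F (symPlus p t) f := by
      rw [Induced.smul_mk, mul_one]
    exact ((isAbelianCompl_qMinus p).symU_smul_mk_of_lie_eq_zero
      (fun y hy => pPlus_lie_mk_one ⟨y, hy⟩ e) t _).trans (congrArg _ h0)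
  rw [T_mk, mul_smul, h1]
  refine (isAbelianCompl_qPlus p).symU_smul_mk_sub_mem le_sup_right (fun r s hs => ?_) k
    (fun z hz w hw => ?_) r hs ?_
  · rw [inducedFil_qPlus]
    exact mk_mem_degLE _ _ le_rfl (symMinus_mem hs) e
  · rw [inducedFil_qMinus] at hw ⊢
    exact (isAbelianCompl_qMinus p).smul_mem_degLE _ ⟨z, mem_qMinus_of_mem_pMinus hz⟩ hw
  · rw [inducedFil_qMinus]
    exact mk_mem_degLE _ _ le_rfl (symPlus_mem ht) f

theorem prev_mono {W : Type*} [AddCommGroup W] [Module ℂ W] [Module (U (sp p)) W]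
    [IsScalarTower ℂ (U (sp p)) W] (Φ : CartanFiltration p W) : Monotone Φ.prev :=
  monotone_nat_of_le_succ fun
    | 0 => bot_le
    | n + 1 => Φ.mono n

/-- The factor from U(𝔨') crosses the tensor sign and is absorbed by E ⊗ F, leaving only products s
t. -/
theorem filV_le {n : ℕ} {S : Submodule ℂ (V p E F)}
    (h : ∀ r k, r + k ≤ n → ∀ s ∈ (SymmetricAlgebra.ι ℂ (pMinus p)).range ^ r,
      ∀ t ∈ (SymmetricAlgebra.ι ℂ (pPlus p)).range ^ k, ∀ e f,
      V.mk p E F (symMinus p s * symPlus p t) (e ⊗ₜ f) ∈ S) : (filV p E F).F n ≤ S := by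
  refine inducedFil_le _ _ fun r k hrk u hu v hv w hw x => ?_
  obtain ⟨a, rfl⟩ := hw
  rw [imU, ← (isAbelianCompl_qPlus p).map_symU] at hu
  rw [imU, ← (isAbelianCompl_qMinus p).map_symU] at hv
  obtain ⟨s, hs, rfl⟩ := hu
  obtain ⟨t, ht, rfl⟩ := hv
  rw [← mul_assoc]
  change V.mk p E F (symMinus p s * symPlus p t * kToG p a) x ∈ S
  rw [Induced.mk_mul]
  generalize envAct (kLie p) (E ⊗[ℂ] F) a x = y
  induction y using TensorProduct.induction_on with
  | zero => rw [map_zero]; exact zero_mem _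
  | add y y' hy hy' => rw [map_add]; exact add_mem hy hy'
  | tmul e f => exact h r k hrk s hs t ht e f

theorem exists_mem_filVTensor (x : VTensor p E F) : ∃ n, x ∈ (filVTensor p E F).F n := by
  have hmono : Monotone (filVTensor p E F).F := monotone_nat_of_le_succ (filVTensor p E F).mono
  change VPlus p E ⊗[ℂ] VMinus p F at x
  induction x using TensorProduct.induction_on with
  | zero => exact ⟨0, zero_mem _⟩
  | add a b ha hb =>
    obtain ⟨m, hm⟩ := ha
    obtain ⟨n, hn⟩ := hb
    exact ⟨m + n, add_mem (hmono (Nat.le_add_right m n) hm) (hmono (Nat.le_add_left n m) hn)⟩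
  | tmul v w =>
    obtain ⟨m, hm⟩ := exists_mem_inducedFil _ _ v
    obtain ⟨n, hn⟩ := exists_mem_inducedFil _ _ w
    exact ⟨m + n, Submodule.mem_iSup_of_mem m (Submodule.mem_iSup_of_mem n
      (Submodule.mem_iSup_of_mem le_rfl (Submodule.apply_mem_map₂ _ hm hn)))⟩

-- Both filtrations are spanned in each degree by vectors indexed by the same data (s, t, e, f), and
-- b matches them one by one; this gives equality of images, and the error estimate need only be
-- checked on these vectors.
variable (p E F) in
theorem exists_isApproxInverse :
    ∃ b, CartanFiltration.IsApproxInverse (filV p E F) (filVTensor p E F) (T p E F) b := by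
  obtain ⟨b, hb⟩ := exists_inverse p E F
  refine ⟨b, fun n => le_antisymm ?_ ?_, fun n w hw => ?_, exists_mem_inducedFil _ _,
    exists_mem_filVTensor⟩
  · rw [Submodule.map_le_iff_le_comap]
    refine filVTensor_le fun r k hrk s hs t ht e f => ?_
    rw [Submodule.mem_comap, hb]
    exact mk_mem_inducedFil _ _ hrk (symMinus_mem hs) (symPlus_mem ht) _
  · refine filV_le fun r k hrk s hs t ht e f => ⟨_, ?_, hb s t e f⟩
    exact mk_mem_filVTensor hrk (mk_mem_degLE _ _ le_rfl (symMinus_mem hs) e)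
      (mk_mem_degLE _ _ le_rfl (symPlus_mem ht) f)
  · suffices H : (filVTensor p E F).F n ≤ ((filVTensor p E F).prev n).comap
        ((T p E F).restrictScalars ℂ ∘ₗ b - LinearMap.id) from H hw
    refine filVTensor_le fun r k hrk s hs t ht e f => prev_mono _ hrk ?_
    rw [LinearMap.sub_apply, LinearMap.comp_apply, hb]
    exact T_mk_sub_mem hs ht e f

end Inverse

end SpTensor

end

/-! ### The isomorphism theorem for `T` and its graded map. -/

theorem mainTheorem4 (p : ℕ) (E F : Type*)
    [AddCommGroup E] [Module ℂ E] [FiniteDimensional ℂ E]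
    [LieRingModule (SpTensor.kLie p) E] [LieModule ℂ (SpTensor.kLie p) E]
    [AddCommGroup F] [Module ℂ F] [FiniteDimensional ℂ F]
    [LieRingModule (SpTensor.kLie p) F] [LieModule ℂ (SpTensor.kLie p) F] :
    -- `T` is the natural map
    (∀ (e : E) (f : F),
      SpTensor.T p E F
          (SpTensor.Induced.mk (SpTensor.kToG p) (SpTensor.envAct (SpTensor.kLie p) (E ⊗[ℂ] F)) 1
            (e ⊗ₜ[ℂ] f)) =
        SpTensor.DiagTensor.mk (SpTensor.sp p) (SpTensor.VPlus p E) (SpTensor.VMinus p F)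
          (SpTensor.Induced.mk (SpTensor.qPlusToG p) (SpTensor.plusAct p E) 1 e)
          (SpTensor.Induced.mk (SpTensor.qMinusToG p) (SpTensor.minusAct p F) 1 f)) ∧
    -- `T` is an isomorphism of `U(𝔤')`-modules
    (∃ Φ : SpTensor.V p E F ≃ₗ[SpTensor.U (SpTensor.sp p)] SpTensor.VTensor p E F,
      ∀ v, Φ v = SpTensor.T p E F v) ∧
    -- `T` preserves the filtrations, and `Gr T` is an isomorphism of `S(𝔭')`-modules
    (∃ hT : SpTensor.CartanFiltration.Preserves (SpTensor.filV p E F) (SpTensor.filVTensor p E F)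
        (SpTensor.T p E F),
      ∃ Ψ : (SpTensor.filV p E F).Gr ≃ₗ[SymmetricAlgebra ℂ (SpTensor.pPrime p)]
          (SpTensor.filVTensor p E F).Gr,
        ∀ v, Ψ v = hT.grMap v) := by
  obtain ⟨b, hb⟩ := SpTensor.exists_isApproxInverse p E F
  exact ⟨SpTensor.T_one p E F, hb.exists_equiv⟩
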